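/- Let $n\ge 1$. Write $H_2(\mu)=\begin{bmatrix}0&1\\ \mu&0\end{bmatrix}$; for $k\ge1$ let $J_k(\mu)$ be the upper triangular $k\times k$ Jordan block with eigenvalue $\mu$, $H_{2k}(\mu)=\begin{bmatrix}0&I_k\\ J_k(\mu)&0\end{bmatrix}$, and let $\Gamma_k$ be the $k\times k$ matrix whose entries in the positions $(i,k+1-i)$ and $(i,k+2-i)$ are $(-1)^{k+i}$ and whose other entries are $0$ (so $\Gamma_1=1$). Every $A\in\mathbb C^{n\times n}$ is congruent (i.e. equal to $PCP^\top$, $P$ invertible) to a direct sum $C=\bigoplus_j J_{k_j}(0)\oplus\bigoplus_j\Gamma_{l_j}\oplus\bigoplus_j H_{2m_j}(\mu_j)\oplus\bigoplus_j H_{2p_j}((-1)^{p_j})$, unique up to permutation of summands, where each $\mu_j$ satisfies (*) $|\mu_j|>1$, or $\mu_j=e^{\mathfrak i\theta_j}$ with $0<\theta_j<\pi$. The congruence bundle $\mathcal B^c(A)$ is the set of all matrices that are congruent to a matrix obtained from $C$ by replacing the $\mu_j$ by numbers $\widetilde\mu_j$ that satisfy (*) and $\widetilde\mu_i\ne\widetilde\mu_j\Leftrightarrow\mu_i\ne\mu_j$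 for all $i,j$. Every $A\in\mathbb C^{n\times n}$ is $^*$congruent (i.e. equal to $PCP^*$, $P$ invertible) to a direct sum $C=\bigoplus_i J_{k_i}(0)\oplus\bigoplus_i\alpha_i\Gamma_{l_i}\oplus\bigoplus_i H_{2m_i}(\mu_i)$ with $|\alpha_i|=1$, $|\mu_i|>1$, unique up to permutation of summands. The $^*$congruence bundle $\mathcal B^*(A)$ is the set of all matrices that are $^*$congruent to a matrix obtained from $C$ by replacing the $\alpha_i,\mu_i$ by numbers $\widetilde\alpha_i,\widetilde\mu_i$ with $|\widetilde\alpha_i|=1$, $|\widetilde\mu_i|>1$ such that for all $i,j$: $\widetilde\alpha_i^2\ne\widetilde\alpha_j^2\Leftrightarrow\alpha_i^2\ne\alpha_j^2$ if $l_i\equiv l_j \pmod 2$; $\widetilde\alpha_i^2\ne-\widetilde\alpha_j^2\Leftrightarrow\alpha_i^2\ne-\alpha_j^2$ if $l_i\not\equiv l_j\pmod 2$; and $\widetilde\mu_i\ne\widetilde\mu_j\Leftrightarrow\mu_i\ne\mu_j$. Let $$\mathcal G=\mathcal B^c\Big(\bigoplus_{i=1}^{n/2}H_2(\mu_i)\Big)\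 (n\text{ even}),\qquad \mathcal G=\mathcal B^c\Big(\bigoplus_{i=1}^{\lfloor n/2\rfloor}H_2(\mu_i)\oplus 1\Big)\ (n\text{ odd}),$$ where the $\mu_i$ are pairwise distinct and satisfy (*). For $\ell=0,1,\dots,\lfloor n/2\rfloor$ let $$\mathcal G_\ell=\mathcal B^*\Big(\bigoplus_{i=1}^{\ell}H_2(\mu_i)\oplus\bigoplus_{j=1}^{n-2\ell}\alpha_j\Big),$$ where the $\mu_i$ are pairwise distinct with $|\mu_i|>1$, $|\alpha_j|=1$, and the $\alpha_j^2$ are pairwise distinct. Then the following hold for all such choices of the parameters (which may be chosen separately for each $\ell$). (a) $\mathcal G$ is an open subset of $\mathbb C^{n\times n}$: for every $A\in\mathcal G$ there is $\varepsilon>0$ with $\{S\in\mathbb C^{n\times n}:\|A-S\|_F<\varepsilon\}\subseteq\mathcal G$, where $\|\cdot\|_F$ is the Frobenius norm. Moreover, $\mathcal G$ is dense in $\mathbb C^{n\times n}$. (b) For every $\ell=0,1,\dots,\lfloor n/2\rfloor$, $\mathcal G_\ell$ is an open subset of $\mathbb C^{n\times n}$: for every $A\in\mathcal G_\ell$ there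 is $\varepsilon>0$ with $\{S\in\mathbb C^{n\times n}:\|A-S\|_F<\varepsilon\}\subseteq\mathcal G_\ell$. Moreover, the union $\bigcup_{\ell=0}^{\lfloor n/2\rfloor}\mathcal G_\ell$ is open and dense in $\mathbb C^{n\times n}$. -/

import Mathlib

namespace GenericBundles

noncomputable section

open Matrix

/-- Square complex matrices of order `n`. -/
abbrev SqMat (n : ℕ) := Matrix (Fin n) (Fin n) ℂ

/-- The Frobenius norm `‖A‖_F`. -/
def frobeniusNorm {n : ℕ} (A : SqMat n) : ℝ :=
  letI : NormedAddCommGroup (SqMat n) := Matrix.frobeniusNormedAddCommGroup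
  ‖A‖

/-- The ball `{S : ‖A - S‖_F < ε}`. -/
def frobeniusBall {n : ℕ} (A : SqMat n) (ε : ℝ) : Set (SqMat n) :=
  {S | frobeniusNorm (A - S) < ε}

/-! ### Direct sums -/

/-- A matrix of order `p`, regarded as one of order `n` when `p = n`. -/
def resize {p n : ℕ} (h : p = n) (A : SqMat p) : SqMat n :=
  reindex (finCongr h) (finCongr h) A

/-- The direct sum `A ⊕ B`. -/
def dirSum {p q : ℕ} (A : SqMat p) (B : SqMat q) : SqMat (p + q) :=
  reindex finSumFinEquiv finSumFinEquiv (fromBlocks A 0 0 B)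

/-- The direct sum `A 0 ⊕ A 1 ⊕ ⋯ ⊕ A (r - 1)` (of order `0` if `r = 0`). -/
def bigDirSum {r : ℕ} {k : Fin r → ℕ} (A : ∀ i, SqMat (k i)) : SqMat (∑ i, k i) :=
  reindex finSigmaFinEquiv finSigmaFinEquiv (blockDiagonal' A)

/-! ### Canonical blocks -/

/-- The Jordan block `J_k(μ)`, with ones on the superdiagonal. -/
def jordanBlk (k : ℕ) (μ : ℂ) : SqMat k :=
  of fun i j => if i = j then μ else if (i : ℕ) + 1 = j then 1 else 0

/-- The block `Γ_k`: its nonzero entries are on the antidiagonal and on the parallel just below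
it; both nonzero entries of a row are equal, they are `1` in the last row, and the sign alternates
from one row to the next. (Rows and columns are numbered from `0`.) -/
def gammaBlk (k : ℕ) : SqMat k :=
  of fun i j =>
    if (i : ℕ) + j + 1 = k ∨ (i : ℕ) + j = k then (-1) ^ (k + (i : ℕ) + 1) else 0

/-- The block `H_{2k}(μ) = [0, I_k; J_k(μ), 0]`. -/
def hBlk (k : ℕ) (μ : ℂ) : SqMat (k + k) :=
  reindex finSumFinEquiv finSumFinEquiv (fromBlocks 0 1 (jordanBlk k μ) 0)

/-! ### Congruence bundles -/

/-- The parameters allowed in the Type II-(a) blocks of the canonical form for congruence: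
`|μ| > 1`, or `μ = e^{iθ}` with `0 < θ < π`. -/
def IsTypeIIa (μ : ℂ) : Prop :=
  1 < ‖μ‖ ∨ ∃ θ : ℝ, 0 < θ ∧ θ < Real.pi ∧ μ = Complex.exp (θ * Complex.I)

/-- The numbers and the sizes of the blocks of a canonical form for congruence of order `n`,
`⨁ J_{k_j}(0) ⊕ ⨁ Γ_{l_j} ⊕ ⨁ H_{2 m_j}(μ_j) ⊕ ⨁ H_{2 p_j}((-1)^{p_j})`. -/
structure CFCShape (n : ℕ) where
  n₁ : ℕ
  n₂ : ℕ
  n₃ : ℕ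
  n₄ : ℕ
  k : Fin n₁ → ℕ
  l : Fin n₂ → ℕ
  m : Fin n₃ → ℕ
  p : Fin n₄ → ℕ
  k_pos : ∀ j, 1 ≤ k j
  l_pos : ∀ j, 1 ≤ l j
  m_pos : ∀ j, 1 ≤ m j
  p_pos : ∀ j, 1 ≤ p j
  size_eq : (∑ j, k j) + (∑ j, l j) + (∑ j, (m j + m j)) + (∑ j, (p j + p j)) = n

/-- The canonical matrix for congruence with given block sizes and parameters `μ_j`. -/
def CFCShape.form {n : ℕ} (s : CFCShape n) (μ : Fin s.n₃ → ℂ) : SqMat n :=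
  resize s.size_eq
    (dirSum (dirSum (dirSum
      (bigDirSum fun j => jordanBlk (s.k j) 0)
      (bigDirSum fun j => gammaBlk (s.l j)))
      (bigDirSum fun j => hBlk (s.m j) (μ j)))
      (bigDirSum fun j => hBlk (s.p j) ((-1) ^ s.p j)))

/-- `A` and `B` are congruent: `A = P B Pᵀ` with `P` invertible. -/
def Congruent {n : ℕ} (A B : SqMat n) : Prop :=
  ∃ P : SqMat n, IsUnit P ∧ A = P * B * Pᵀ

/-- The congruence bundle `ℬᶜ(A)`. Here `s.form μ` is the canonical form for congruence of `A`,
which is unique up to a permutation of its summands. -/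
def congruenceBundle {n : ℕ} (A : SqMat n) : Set (SqMat n) :=
  {M | ∃ (s : CFCShape n) (μ : Fin s.n₃ → ℂ),
    (∀ j, IsTypeIIa (μ j)) ∧ Congruent A (s.form μ) ∧
    ∃ μ' : Fin s.n₃ → ℂ, (∀ j, IsTypeIIa (μ' j)) ∧
      (∀ i j, μ' i ≠ μ' j ↔ μ i ≠ μ j) ∧
      Congruent M (s.form μ')}

/-! ### `*`congruence bundles -/

/-- The numbers and the sizes of the blocks of a canonical form for `*`congruence of order `n`,
`⨁ J_{k_i}(0) ⊕ ⨁ α_i Γ_{l_i} ⊕ ⨁ H_{2 m_i}(μ_i)`. -/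
structure StarCFCShape (n : ℕ) where
  n₁ : ℕ
  n₂ : ℕ
  n₃ : ℕ
  k : Fin n₁ → ℕ
  l : Fin n₂ → ℕ
  m : Fin n₃ → ℕ
  k_pos : ∀ i, 1 ≤ k i
  l_pos : ∀ i, 1 ≤ l i
  m_pos : ∀ i, 1 ≤ m i
  size_eq : (∑ i, k i) + (∑ i, l i) + (∑ i, (m i + m i)) = n

/-- The canonical matrix for `*`congruence with given block sizes and parameters `α_i`, `μ_i`. -/
def StarCFCShape.form {n : ℕ} (s : StarCFCShape n) (α : Fin s.n₂ → ℂ) (μ : Fin s.n₃ → ℂ) :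
    SqMat n :=
  resize s.size_eq
    (dirSum (dirSum
      (bigDirSum fun i => jordanBlk (s.k i) 0)
      (bigDirSum fun i => α i • gammaBlk (s.l i)))
      (bigDirSum fun i => hBlk (s.m i) (μ i)))

/-- `A` and `B` are `*`congruent: `A = P B P*` with `P` invertible. -/
def StarCongruent {n : ℕ} (A B : SqMat n) : Prop :=
  ∃ P : SqMat n, IsUnit P ∧ A = P * B * Pᴴ

/-- The `*`congruence bundle `ℬ*(A)`. Here `s.form α μ` is the canonical form for `*`congruence
of `A`, which is unique up to a permutation of its summands. -/
def starCongruenceBundle {n : ℕ} (A : SqMat n) : Set (SqMat n) :=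
  {M | ∃ (s : StarCFCShape n) (α : Fin s.n₂ → ℂ) (μ : Fin s.n₃ → ℂ),
    (∀ i, ‖α i‖ = 1) ∧ (∀ i, 1 < ‖μ i‖) ∧ StarCongruent A (s.form α μ) ∧
    ∃ (α' : Fin s.n₂ → ℂ) (μ' : Fin s.n₃ → ℂ),
      (∀ i, ‖α' i‖ = 1) ∧ (∀ i, 1 < ‖μ' i‖) ∧
      (∀ i j, s.l i % 2 = s.l j % 2 → (α' i ^ 2 ≠ α' j ^ 2 ↔ α i ^ 2 ≠ α j ^ 2)) ∧
      (∀ i j, s.l i % 2 ≠ s.l j % 2 → (α' i ^ 2 ≠ -α' j ^ 2 ↔ α i ^ 2 ≠ -α j ^ 2)) ∧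
      (∀ i j, μ' i ≠ μ' j ↔ μ i ≠ μ j) ∧
      StarCongruent M (s.form α' μ')}

/-! ### Generic canonical forms and generic bundles -/

theorem genericCFC_size (n : ℕ) :
    (∑ _i : Fin (n / 2), (1 + 1)) + (∑ _j : Fin (n % 2), 1) = n := by
  simp; omega

theorem genericStarCFC_size {n ℓ : ℕ} (hℓ : ℓ ≤ n / 2) :
    (∑ _i : Fin ℓ, (1 + 1)) + (∑ _j : Fin (n - 2 * ℓ), 1) = n := by
  simp; omega

/-- `H_2(μ_1) ⊕ ⋯ ⊕ H_2(μ_{⌊n/2⌋})` if `n` is even, and the same matrix followed by one summand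
`Γ_1 = 1` if `n` is odd. -/
def genericCFC (n : ℕ) (μ : Fin (n / 2) → ℂ) : SqMat n :=
  resize (genericCFC_size n)
    (dirSum (bigDirSum fun i => hBlk 1 (μ i)) (bigDirSum fun _ : Fin (n % 2) => gammaBlk 1))

/-- `H_2(μ_1) ⊕ ⋯ ⊕ H_2(μ_ℓ) ⊕ α_1 ⊕ ⋯ ⊕ α_{n-2ℓ}`, where `0 ≤ ℓ ≤ ⌊n/2⌋`. -/
def genericStarCFC {n ℓ : ℕ} (hℓ : ℓ ≤ n / 2) (μ : Fin ℓ → ℂ) (α : Fin (n - 2 * ℓ) → ℂ) :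
    SqMat n :=
  resize (genericStarCFC_size hℓ)
    (dirSum (bigDirSum fun i => hBlk 1 (μ i)) (bigDirSum fun j => α j • gammaBlk 1))

/-- The conditions on the parameters of the generic canonical form for congruence. -/
def GenericParams {r : ℕ} (μ : Fin r → ℂ) : Prop :=
  (∀ i, IsTypeIIa (μ i)) ∧ ∀ i j, i ≠ j → μ i ≠ μ j

/-- The conditions on the parameters of a generic canonical form for `*`congruence. -/
def GenericStarParams {r t : ℕ} (μ : Fin r → ℂ) (α : Fin t → ℂ) : Prop :=
  (∀ i, 1 < ‖μ i‖) ∧ (∀ i j, i ≠ j → μ i ≠ μ j) ∧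
    (∀ i, ‖α i‖ = 1) ∧ ∀ i j, i ≠ j → α i ^ 2 ≠ α j ^ 2

/-- The generic congruence bundle `𝒢` (generated by the parameters `μ`). -/
def genericBundle (n : ℕ) (μ : Fin (n / 2) → ℂ) : Set (SqMat n) :=
  congruenceBundle (genericCFC n μ)

/-- The generic `*`congruence bundle `𝒢_ℓ` (generated by the parameters `μ`, `α`). -/
def genericStarBundle {n ℓ : ℕ} (hℓ : ℓ ≤ n / 2) (μ : Fin ℓ → ℂ) (α : Fin (n - 2 * ℓ) → ℂ) :
    Set (SqMat n) :=
  starCongruenceBundle (genericStarCFC hℓ μ α)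

end

end GenericBundles

open GenericBundles

/-! Congruence and `*`congruence are treated together as A ↦ P A (τP)ᵀ, with τ the identity or the
conjugation. The polynomial det(A - z (τA)ᵀ) is then only multiplied by a nonzero constant, so its
roots are invariants; the nonzero ones are permuted by the involution z ↦ (τz)⁻¹. The proof
identifies the bundles with sets described by these roots. Call A separable (`IsSep`) if it is
nonsingular and its n roots are distinct.

In a canonical form, J_k(0) makes A singular, a block Γ_l has a single root of multiplicity l, and
H_{2m}(μ) has the roots μ and (τμ)⁻¹, each m times. Hence a separable form has only blocks of the
smallest size with distinct roots, and the bundle conditions preserve this. Conversely, the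
eigenvectors of a separable A form a basis in which A pairs the vector of z only with that of (τz)⁻¹
(`exists_monomial_gram`); rescaling gives the generic form (`exists_twistedCongruent_normalForm`).

For congruence, a fixed root must be 1, so there is at most one and parity decides: 𝒢 is the set of
all separable matrices (`genericBundle_eq`). For `*`congruence the fixed roots are the unimodular
ones, and 𝒢_ℓ consists of the separable matrices with exactly ℓ roots outside the unit circle
(`genericStarBundle_eq`); the union over ℓ is again the set of all separable matrices.

Openness is continuity of simple roots, together with the fact that a simple fixed root cannot leave
the fixed set without splitting into two roots (`isOpen_hasRootType`). Density holds because on the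
real line from any matrix to a separable one, a resultant vanishes at only finitely many points
(`dense_isSep`). -/

namespace GenericBundles

open Matrix Polynomial Filter Topology

noncomputable section

/-! ### The pencil of a matrix -/

section Pencil

variable {m m' : Type*} [Fintype m] [DecidableEq m] [Fintype m'] [DecidableEq m']

/-- The matrix pencil `A - X • (A.map τ)ᵀ`. -/
def pencilMat {m : Type*} (τ : ℂ →+* ℂ) (A : Matrix m m ℂ) : Matrix m m ℂ[X] :=
  of fun i j => C (A i j) - X * C (τ (A j i))

/-- The polynomial `det (A - X • (A.map τ)ᵀ)`. -/
def pencil (τ : ℂ →+* ℂ) (A : Matrix m m ℂ) : ℂ[X] := (pencilMat τ A).det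

theorem pencilMat_eq {m : Type*} (τ : ℂ →+* ℂ) (A : Matrix m m ℂ) :
    pencilMat τ A = (X : ℂ[X]) • (-(A.map τ)ᵀ).map C + A.map C := by
  ext1 i j
  simp [pencilMat]
  ring

theorem natDegree_pencil_le (τ : ℂ →+* ℂ) (A : Matrix m m ℂ) :
    (pencil τ A).natDegree ≤ Fintype.card m := by
  rw [pencil, pencilMat_eq]
  exact natDegree_det_X_add_C_le _ _

theorem det_map_transpose (τ : ℂ →+* ℂ) (A : Matrix m m ℂ) : ((A.map τ)ᵀ).det = τ A.det := by
  rw [det_transpose, RingHom.map_det]; rfl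

theorem coeff_pencil_card (τ : ℂ →+* ℂ) (A : Matrix m m ℂ) :
    (pencil τ A).coeff (Fintype.card m) = (-1) ^ Fintype.card m * τ A.det := by
  rw [pencil, pencilMat_eq, coeff_det_X_add_C_card, det_neg, det_map_transpose]

theorem eval_pencil (τ : ℂ →+* ℂ) (A : Matrix m m ℂ) (z : ℂ) :
    (pencil τ A).eval z = (A - z • (A.map τ)ᵀ).det := by
  rw [pencil, ← coe_evalRingHom, RingHom.map_det]
  congr 1
  ext i j
  simp [pencilMat]
  ring

theorem eval_zero_pencil (τ : ℂ →+* ℂ) (A : Matrix m m ℂ) : (pencil τ A).eval 0 = A.det := by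
  simp [eval_pencil]

theorem natDegree_pencil (τ : ℂ →+* ℂ) {A : Matrix m m ℂ} (hA : A.det ≠ 0) :
    (pencil τ A).natDegree = Fintype.card m := by
  refine le_antisymm (natDegree_pencil_le τ A) (le_natDegree_of_ne_zero ?_)
  rw [coeff_pencil_card]
  simpa using hA

theorem pencil_ne_zero (τ : ℂ →+* ℂ) {A : Matrix m m ℂ} (hA : A.det ≠ 0) : pencil τ A ≠ 0 := by
  intro h
  rw [← eval_zero_pencil τ, h] at hA
  simp at hA

theorem pencil_reindex (τ : ℂ →+* ℂ) (e : m ≃ m') (A : Matrix m m ℂ) :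
    pencil τ (reindex e e A) = pencil τ A := by
  have : pencilMat τ (reindex e e A) = reindex e e (pencilMat τ A) := rfl
  rw [pencil, this, det_reindex_self, pencil]

theorem pencil_fromBlocks (τ : ℂ →+* ℂ) (A : Matrix m m ℂ) (B : Matrix m' m' ℂ) :
    pencil τ (fromBlocks A 0 0 B) = pencil τ A * pencil τ B := by
  have : pencilMat τ (fromBlocks A 0 0 B) = fromBlocks (pencilMat τ A) 0 0 (pencilMat τ B) := by
    ext1 i j
    rcases i with i | i <;> rcases j with j | j <;> simp [pencilMat]
  rw [pencil, this, det_fromBlocks_zero₂₁, pencil, pencil]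

theorem det_blockDiagonal' {o R : Type*} [CommRing R] [Fintype o] [LinearOrder o]
    {k : o → Type*} [∀ i, Fintype (k i)] [∀ i, DecidableEq (k i)]
    (M : ∀ i, Matrix (k i) (k i) R) : (blockDiagonal' M).det = ∏ i, (M i).det := by
  rw [(blockTriangular_blockDiagonal' M).det_fintype]
  refine Finset.prod_congr rfl fun i _ => ?_
  rw [← det_reindex_self (Equiv.sigmaSubtype i)]
  congr 1
  ext a b
  simp [toSquareBlock_def, Equiv.sigmaSubtype, blockDiagonal'_apply_eq]

theorem pencil_blockDiagonal' (τ : ℂ →+* ℂ) {o : Type*} [Fintype o] [LinearOrder o]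
    {k : o → Type*} [∀ i, Fintype (k i)] [∀ i, DecidableEq (k i)]
    (M : ∀ i, Matrix (k i) (k i) ℂ) : pencil τ (blockDiagonal' M) = ∏ i, pencil τ (M i) := by
  have : pencilMat τ (blockDiagonal' M) = blockDiagonal' fun i => pencilMat τ (M i) := by
    ext1 ⟨i, a⟩ ⟨j, b⟩
    by_cases h : i = j
    · subst h
      simp [pencilMat, blockDiagonal'_apply_eq]
    · simp [pencilMat, blockDiagonal'_apply_ne _ _ _ h, blockDiagonal'_apply_ne _ _ _ (Ne.symm h)]
  rw [pencil, this, det_blockDiagonal']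
  rfl

theorem pencil_resize (τ : ℂ →+* ℂ) {p n : ℕ} (h : p = n) (A : SqMat p) :
    pencil τ (resize h A) = pencil τ A := pencil_reindex τ _ A

theorem pencil_dirSum (τ : ℂ →+* ℂ) {p q : ℕ} (A : SqMat p) (B : SqMat q) :
    pencil τ (dirSum A B) = pencil τ A * pencil τ B := by
  rw [dirSum, pencil_reindex, pencil_fromBlocks]

theorem pencil_bigDirSum (τ : ℂ →+* ℂ) {r : ℕ} {k : Fin r → ℕ} (A : ∀ i, SqMat (k i)) :
    pencil τ (bigDirSum A) = ∏ i, pencil τ (A i) := by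
  rw [bigDirSum, pencil_reindex, pencil_blockDiagonal']

/-- As τ is an involution, both coefficients A and (τA)ᵀ of the pencil are multiplied by the same
matrices P and (τP)ᵀ. -/
theorem pencil_congr {τ : ℂ →+* ℂ} (hτ : ∀ z, τ (τ z) = z) (P A : Matrix m m ℂ) :
    pencil τ (P * A * (P.map τ)ᵀ) = C (P.det * τ P.det) * pencil τ A := by
  have hP : (P.map τ).map τ = P := by ext i j; simp [hτ]
  have : pencilMat τ (P * A * (P.map τ)ᵀ) = P.map C * pencilMat τ A * ((P.map τ)ᵀ).map C := by
    have h1 : ((P * A * (P.map τ)ᵀ).map τ)ᵀ = P * (A.map τ)ᵀ * (P.map τ)ᵀ := by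
      rw [Matrix.map_mul, Matrix.map_mul, transpose_map (M := P.map τ), hP, transpose_mul,
        transpose_mul, transpose_transpose, Matrix.mul_assoc]
    rw [pencilMat_eq, pencilMat_eq, h1]
    have h2 : -(P * (A.map τ)ᵀ * (P.map τ)ᵀ) = P * (-(A.map τ)ᵀ) * (P.map τ)ᵀ := by
      simp
    rw [h2, Matrix.mul_add, Matrix.add_mul]
    simp only [Matrix.map_mul, Matrix.mul_smul, Matrix.smul_mul]
  rw [pencil, this, det_mul, det_mul, pencil]
  have h3 : (P.map C).det = C P.det := (RingHom.map_det C P).symm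
  have h4 : (((P.map τ)ᵀ).map C).det = C (τ P.det) := by
    rw [← det_map_transpose]; exact (RingHom.map_det C _).symm
  rw [h3, h4, C_mul]
  ring

/-- The nonzero roots of the pencil are stable under `z ↦ (τ z)⁻¹`. -/
theorem isRoot_pencil_inv {τ : ℂ →+* ℂ} (hτ : ∀ z, τ (τ z) = z) {A : Matrix m m ℂ} {z : ℂ}
    (hz : z ≠ 0) (h : (pencil τ A).IsRoot z) : (pencil τ A).IsRoot (τ z)⁻¹ := by
  have hz' : τ z ≠ 0 := by simpa using hz
  rw [IsRoot, eval_pencil] at h ⊢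
  have h1 := congrArg τ h
  rw [← det_map_transpose, map_zero] at h1
  -- Applying τ and transposing interchanges the two coefficients of the pencil.
  have h2 : ((A - z • (A.map τ)ᵀ).map τ)ᵀ = (-τ z) • (A - (τ z)⁻¹ • (A.map τ)ᵀ) := by
    ext i j
    simp [hτ, mul_sub, hz']
    ring
  rw [h2, det_smul] at h1
  simpa [hz'] using h1

theorem ne_zero_of_isRoot_pencil {τ : ℂ →+* ℂ} {A : Matrix m m ℂ} (hA : A.det ≠ 0) {z : ℂ}
    (h : (pencil τ A).IsRoot z) : z ≠ 0 := by
  rintro rfl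
  exact hA (by rw [← eval_zero_pencil τ]; exact h)

end Pencil

/-! ### The pencils of the canonical blocks -/

theorem det_jordanBlk_zero {k : ℕ} (hk : 1 ≤ k) : (jordanBlk k 0).det = 0 := by
  rw [det_of_isUpperTriangular]
  · exact Finset.prod_eq_zero (Finset.mem_univ ⟨0, hk⟩) (by simp [jordanBlk])
  · intro i j hij
    have hij : j < i := hij
    have h1 : i ≠ j := hij.ne'
    have h2 : ¬ ((i : ℕ) + 1 = j) := by have := Fin.lt_def.1 hij; omega
    simp [jordanBlk, h1, h2]

/-- Reversing the columns makes the pencil lower triangular, with diagonal entries that agree up to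
sign; these signs and that of the reversal go into c. -/
theorem pencil_smul_gammaBlk (τ : ℂ →+* ℂ) (l : ℕ) (a : ℂ) : ∃ c : ℂ, c ≠ 0 ∧
    pencil τ (a • gammaBlk l) = C c * (C (a * (-1) ^ (l + 1)) - X * C (τ a)) ^ l := by
  set G := pencilMat τ (a • gammaBlk l) with hG
  have hdet := det_permute' (Fin.revPerm (n := l)) G
  have hlow : (G.submatrix id (Fin.revPerm (n := l))).det =
      ∏ i : Fin l, (C ((-1) ^ (i : ℕ)) * (C (a * (-1) ^ (l + 1)) - X * C (τ a))) := by
    rw [det_of_isLowerTriangular]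
    · refine Finset.prod_congr rfl fun i _ => ?_
      have h1 : (i : ℕ) + (l - (i + 1)) + 1 = l := by omega
      have h2 : (l - ((i : ℕ) + 1)) + i + 1 = l := by omega
      have e1 : ((-1) ^ (l + (i : ℕ) + 1) : ℂ) = (-1) ^ (i : ℕ) * (-1) ^ (l + 1) := by
        rw [← pow_add]; congr 1; omega
      have e2 : ((-1) ^ (l + (l - ((i : ℕ) + 1)) + 1) : ℂ) = (-1) ^ (i : ℕ) := by
        have : l + (l - ((i : ℕ) + 1)) + 1 = i + 2 * (l - i) := by omega
        rw [this, pow_add, pow_mul]; simp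
      simp only [hG, pencilMat, gammaBlk, submatrix_apply, of_apply, Matrix.smul_apply, smul_eq_mul, id,
        Fin.revPerm_apply, Fin.val_rev, h1, h2, true_or, if_true, e1, e2, map_mul, map_pow,
        map_neg, map_one]
      ring
    · intro i j hij
      have hij : i < j := hij
      have hij := Fin.lt_def.1 hij
      have hj := j.2
      have h1 : ¬ ((i : ℕ) + (l - (j + 1)) + 1 = l) := by omega
      have h2 : ¬ ((i : ℕ) + (l - (j + 1)) = l) := by omega
      have h3 : ¬ ((l - ((j : ℕ) + 1)) + i + 1 = l) := by omega
      have h4 : ¬ ((l - ((j : ℕ) + 1)) + i = l) := by omega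
      simp [hG, pencilMat, gammaBlk, h1, h2, h3, h4]
  rw [hlow, Finset.prod_mul_distrib, Finset.prod_const, Finset.card_univ, Fintype.card_fin,
    ← map_prod] at hdet
  obtain h | h := Int.units_eq_one_or (Equiv.Perm.sign (Fin.revPerm (n := l)))
  · refine ⟨∏ i : Fin l, (-1) ^ (i : ℕ), Finset.prod_ne_zero_iff.2 (by simp), ?_⟩
    rw [hdet, h]
    simp [pencil, hG]
  · refine ⟨-∏ i : Fin l, (-1) ^ (i : ℕ), neg_ne_zero.2 (Finset.prod_ne_zero_iff.2 (by simp)), ?_⟩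
    rw [C_neg, neg_mul, hdet, h]
    simp [pencil, hG]

theorem det_fromBlocks_antidiagonal {m R : Type*} [CommRing R] [Fintype m] [DecidableEq m]
    (B D : Matrix m m R) :
    (fromBlocks 0 B D 0).det = (-1) ^ Fintype.card m * (B.det * D.det) := by
  have h : fromBlocks 0 B D 0 =
      fromBlocks B 0 0 D * fromBlocks (0 : Matrix m m R) (1 : Matrix m m R) (1 : Matrix m m R) 0 := by
    simp [fromBlocks_multiply]
  -- A unitriangular factor turns the block swap into a matrix with identity upper left block, whose
  -- determinant is a Schur complement.
  have h1 : fromBlocks (0 : Matrix m m R) (1 : Matrix m m R) (1 : Matrix m m R) 0 *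
      fromBlocks (1 : Matrix m m R) 0 (1 : Matrix m m R) (1 : Matrix m m R) =
      fromBlocks 1 1 1 0 := by
    simp [fromBlocks_multiply]
  have h2 := congrArg det h1
  rw [det_mul, det_fromBlocks_zero₁₂, det_fromBlocks_one₁₁] at h2
  simp [det_neg] at h2
  rw [h, det_mul, h2, det_fromBlocks_zero₂₁]
  ring

/-- The pencil is block antidiagonal, with I - z (τJ)ᵀ lower triangular and J - z I upper
triangular. -/
theorem pencil_hBlk (τ : ℂ →+* ℂ) (k : ℕ) (μ : ℂ) : ∃ c : ℂ, c ≠ 0 ∧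
    pencil τ (hBlk k μ) = C c * ((1 - X * C (τ μ)) * (C μ - X)) ^ k := by
  refine ⟨(-1) ^ k, by simp, ?_⟩
  have h : pencilMat τ (fromBlocks 0 1 (jordanBlk k μ) 0) =
      fromBlocks 0 (of fun i j => C ((1 : SqMat k) i j) - X * C (τ (jordanBlk k μ j i)))
        (of fun i j => C (jordanBlk k μ i j) - X * C (τ ((1 : SqMat k) j i))) 0 := by
    ext1 i j
    rcases i with i | i <;> rcases j with j | j <;> simp [pencilMat]
  rw [hBlk, pencil_reindex, pencil, h, det_fromBlocks_antidiagonal, det_of_isLowerTriangular,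
    det_of_isUpperTriangular]
  · simp [jordanBlk, mul_pow]
  · intro i j hij
    have hij : j < i := hij
    have h1 : i ≠ j := hij.ne'
    have h2 : ¬ ((i : ℕ) + 1 = j) := by have := Fin.lt_def.1 hij; omega
    simp [jordanBlk, h1, h1.symm, h2]
  · intro i j hij
    have hij : i < j := hij
    have h1 : i ≠ j := hij.ne
    have h2 : ¬ ((j : ℕ) + 1 = i) := by have := Fin.lt_def.1 hij; omega
    simp [jordanBlk, h1, h1.symm, h2]

/-! ### Reduction of a matrix with separable pencil to a normal form -/

/-- Congruence twisted by `τ`: congruence for `τ = id`, `*`congruence for the conjugation. -/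
def TwistedCongruent {m : Type*} [Fintype m] [DecidableEq m] (τ : ℂ →+* ℂ)
    (A B : Matrix m m ℂ) : Prop :=
  ∃ P : Matrix m m ℂ, IsUnit P ∧ A = P * B * (P.map τ)ᵀ

section Reduction

variable {m : Type*} [Fintype m] [DecidableEq m]

theorem TwistedCongruent.pencil_eq {τ : ℂ →+* ℂ} (hτ : ∀ z, τ (τ z) = z) {A B : Matrix m m ℂ}
    (h : TwistedCongruent τ A B) : ∃ c : ℂ, c ≠ 0 ∧ pencil τ A = C c * pencil τ B := by
  obtain ⟨P, hP, rfl⟩ := h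
  have hP' : P.det ≠ 0 := ((isUnit_iff_isUnit_det P).1 hP).ne_zero
  exact ⟨_, mul_ne_zero hP' (by simpa using hP'), pencil_congr hτ P B⟩

/-- In a suitable basis of eigenvectors of the pencil, the Gram matrix of `A` is a monomial
matrix. -/
theorem exists_monomial_gram {τ : ℂ →+* ℂ} (hτ : ∀ z, τ (τ z) = z) {A : Matrix m m ℂ}
    (hA : A.det ≠ 0) {rt : m → ℂ} (hinj : Function.Injective rt)
    (hroot : ∀ x, (pencil τ A).IsRoot (rt x)) {σ : m → m}
    (hσ : ∀ x y, rt y * τ (rt x) = 1 → y = σ x) :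
    ∃ U : Matrix m m ℂ, IsUnit U ∧
      (∀ x y, (U * A * (U.map τ)ᵀ) x y = rt y * τ ((U * A * (U.map τ)ᵀ) y x)) ∧
      (∀ x y, y ≠ σ x → (U * A * (U.map τ)ᵀ) x y = 0) ∧
      ∀ x, (U * A * (U.map τ)ᵀ) x (σ x) ≠ 0 := by
  set B := (A.map τ)ᵀ with hB
  have hBdet : IsUnit B.det := by
    rw [hB, det_map_transpose]; simpa using hA
  have hev : ∀ x, ∃ v : m → ℂ, v ≠ 0 ∧ (A - rt x • B) *ᵥ v = 0 := fun x =>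
    exists_mulVec_eq_zero_iff.2 (by rw [hB, ← eval_pencil]; exact hroot x)
  choose v hv0 hv using hev
  have hv' : ∀ x, A *ᵥ v x = rt x • (B *ᵥ v x) := fun x => by
    have := hv x
    rwa [sub_mulVec, smul_mulVec, sub_eq_zero] at this
  -- The v x are eigenvectors of B⁻¹A for distinct eigenvalues.
  have hli : LinearIndependent ℂ v := by
    refine Module.End.eigenvectors_linearIndependent' (toLin' (B⁻¹ * A)) rt hinj v fun x => ?_
    rw [Module.End.hasEigenvector_iff, Module.End.mem_eigenspace_iff]
    refine ⟨?_, hv0 x⟩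
    rw [toLin'_apply, ← mulVec_mulVec, hv', mulVec_smul, mulVec_mulVec, nonsing_inv_mul _ hBdet,
      one_mulVec]
  set W : Matrix m m ℂ := of fun i x => v x i with hW
  have hWu : IsUnit W := by
    rw [← linearIndependent_cols_iff_isUnit]; exact hli
  -- With this choice the right factor (τU)ᵀ is the eigenvector matrix W itself.
  set U : Matrix m m ℂ := (W.map τ)ᵀ with hU
  have hUW : (U.map τ)ᵀ = W := by ext i j; simp [hU, hτ]
  have hUu : IsUnit U := by
    rw [isUnit_iff_isUnit_det, hU, det_map_transpose]
    exact ((isUnit_iff_isUnit_det W).1 hWu).map τ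
  have hAW : A * W = B * W * diagonal rt := by
    ext i x
    have h1 := congrFun (hv' x) i
    have h2 : (A * W) i x = (A *ᵥ v x) i := rfl
    have h3 : (B * W) i x = (B *ᵥ v x) i := rfl
    rw [mul_diagonal, h2, h3, h1]
    simp [mul_comm]
  set G := U * A * W with hG
  have hGτ : (G.map τ)ᵀ = U * B * W := by
    rw [hG, Matrix.map_mul, Matrix.map_mul, transpose_mul, transpose_mul, hUW, ← hB,
      Matrix.mul_assoc]
  have hsym : ∀ x y, G x y = rt y * τ (G y x) := fun x y => by
    have h1 : G = (G.map τ)ᵀ * diagonal rt := by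
      rw [hGτ, hG, Matrix.mul_assoc, hAW, Matrix.mul_assoc, Matrix.mul_assoc, Matrix.mul_assoc]
    have h2 := congrFun (congrFun h1 x) y
    rw [mul_diagonal] at h2
    rw [h2]
    simp [mul_comm]
  -- Using the symmetry twice gives G x y = rt y * τ (rt x) * G x y.
  have hzero : ∀ x y, y ≠ σ x → G x y = 0 := fun x y hxy => by
    by_contra hne
    have h1 := hsym x y
    rw [hsym y x, map_mul, hτ, ← mul_assoc] at h1
    exact hxy (hσ x y (mul_right_cancel₀ hne (by rw [one_mul]; exact h1.symm)))
  refine ⟨U, hUu, ?_⟩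
  rw [hUW]
  refine ⟨hsym, hzero, fun x hx => ?_⟩
  have hGdet : G.det ≠ 0 := by
    rw [hG, det_mul, det_mul]
    exact mul_ne_zero (mul_ne_zero ((isUnit_iff_isUnit_det U).1 hUu).ne_zero hA)
      ((isUnit_iff_isUnit_det W).1 hWu).ne_zero
  -- Otherwise the whole row x of the nonsingular matrix G would vanish.
  refine hGdet (det_eq_zero_of_row_eq_zero x fun y => ?_)
  by_cases hy : y = σ x
  · rw [hy]; exact hx
  · exact hzero x y hy

end Reduction

/-- The matrix `⨁ α_j ⊕ [0, I; diag μ, 0]`. -/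
def normalForm {t r : ℕ} (α : Fin t → ℂ) (μ : Fin r → ℂ) :
    Matrix (Fin t ⊕ (Fin r ⊕ Fin r)) (Fin t ⊕ (Fin r ⊕ Fin r)) ℂ :=
  fromBlocks (diagonal α) 0 0 (fromBlocks 0 1 (diagonal μ) 0)

/-- The family of numbers `f_j`, `μ_i` and `(τ μ_i)⁻¹`. -/
def rootFun (τ : ℂ →+* ℂ) {t r : ℕ} (f : Fin t → ℂ) (μ : Fin r → ℂ) :
    Fin t ⊕ (Fin r ⊕ Fin r) → ℂ :=
  Sum.elim f (Sum.elim μ fun i => (τ (μ i))⁻¹)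

/-- Rescaling the eigenbasis normalizes the entries that pair μ_i with its partner. A diagonal entry
b_j can only be multiplied by c τ(c); the choice of c is left open because it differs for the two
kinds of congruence. -/
theorem exists_twistedCongruent_normalForm {τ : ℂ →+* ℂ} (hτ : ∀ z, τ (τ z) = z) {n t r : ℕ}
    {A : SqMat n} (hA : A.det ≠ 0) {f : Fin t → ℂ} {μ : Fin r → ℂ}
    (hinj : Function.Injective (rootFun τ f μ)) (hμ : ∀ i, μ i ≠ 0) (hf : ∀ j, f j * τ (f j) = 1)
    (hroot : ∀ x, (pencil τ A).IsRoot (rootFun τ f μ x))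
    (e : Fin t ⊕ (Fin r ⊕ Fin r) ≃ Fin n) :
    ∃ b : Fin t → ℂ, (∀ j, b j ≠ 0) ∧ (∀ j, b j = f j * τ (b j)) ∧
      ∀ c : Fin t → ℂ, (∀ j, c j ≠ 0) →
        TwistedCongruent τ A (reindex e e (normalForm (fun j => c j * τ (c j) * b j) μ)) := by
  set s : Fin t ⊕ (Fin r ⊕ Fin r) → Fin t ⊕ (Fin r ⊕ Fin r) := Sum.map id Sum.swap with hs
  have hrs : ∀ x, rootFun τ f μ (s x) * τ (rootFun τ f μ x) = 1 := by
    have h0 : ∀ i, τ (μ i) ≠ 0 := fun i => by simpa using hμ i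
    rintro (j | i | i)
    · exact hf j
    · simp [hs, rootFun, h0]
    · simp [hs, rootFun, hτ, hμ]
  have hmon := exists_monomial_gram hτ hA (rt := rootFun τ f μ ∘ e.symm)
    (hinj.comp e.symm.injective) (fun x => hroot _) (σ := fun x => e (s (e.symm x)))
    (fun x y hxy => by
      have h1 : τ (rootFun τ f μ (e.symm x)) ≠ 0 := fun h => by
        simp [h] at hxy
      have h2 := mul_right_cancel₀ h1 (hxy.trans (hrs (e.symm x)).symm)
      exact e.symm_apply_eq.1 (hinj h2))
  obtain ⟨U, hU, hsym, hzero, hne⟩ := hmon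
  set G := U * A * (U.map τ)ᵀ with hG
  refine ⟨fun j => G (e (.inl j)) (e (.inl j)), fun j => ?_, fun j => ?_, fun c hc => ?_⟩
  · simpa [hs] using hne (e (.inl j))
  · simpa [rootFun] using hsym (e (.inl j)) (e (.inl j))
  have hp : ∀ i, G (e (.inr (.inl i))) (e (.inr (.inr i))) ≠ 0 := fun i => by
    simpa [hs] using hne (e (.inr (.inl i)))
  have hq : ∀ i, G (e (.inr (.inr i))) (e (.inr (.inl i))) =
      μ i * τ (G (e (.inr (.inl i))) (e (.inr (.inr i)))) := fun i => by
    simpa [rootFun] using hsym (e (.inr (.inr i))) (e (.inr (.inl i)))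
  -- If p pairs the vector of μ_i with its partner, the mirror entry is μ_i τ(p); scaling the vector
  -- of μ_i alone by p⁻¹ turns these into 1 and μ_i.
  set d : Fin t ⊕ (Fin r ⊕ Fin r) → ℂ :=
    Sum.elim c (Sum.elim (fun i => (G (e (.inr (.inl i))) (e (.inr (.inr i))))⁻¹) fun _ => 1)
    with hd
  have hd0 : ∀ x, d x ≠ 0 := by
    rintro (j | i | i)
    · exact hc j
    · exact inv_ne_zero (hp i)
    · exact one_ne_zero
  have hz : ∀ x y, y ≠ s x → G (e x) (e y) = 0 := fun x y hxy =>
    hzero _ _ (by simpa using hxy)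
  have key : reindex e e (normalForm (fun j => c j * τ (c j) * G (e (.inl j)) (e (.inl j))) μ) =
      (diagonal (d ∘ e.symm) * U) * A * ((diagonal (d ∘ e.symm) * U).map τ)ᵀ := by
    have h1 : (diagonal (d ∘ e.symm) * U) * A * ((diagonal (d ∘ e.symm) * U).map τ)ᵀ =
        diagonal (d ∘ e.symm) * G * diagonal (τ ∘ d ∘ e.symm) := by
      have : (diagonal (d ∘ e.symm)).map τ = diagonal (τ ∘ d ∘ e.symm) := by
        rw [diagonal_map (map_zero τ)]; rfl
      rw [Matrix.map_mul, transpose_mul, this, diagonal_transpose, hG]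
      simp only [Matrix.mul_assoc]
    rw [h1]
    ext x' y'
    obtain ⟨x, rfl⟩ := e.surjective x'
    obtain ⟨y, rfl⟩ := e.surjective y'
    rw [mul_diagonal, diagonal_mul]
    simp only [reindex_apply, submatrix_apply, Equiv.symm_apply_apply, Function.comp_apply]
    by_cases hxy : y = s x
    · subst hxy
      rcases x with j | i | i
      · simp [hs, normalForm, hd]; ring
      · simp [hs, normalForm, hd, hp]
      · have : τ (G (e (.inr (.inl i))) (e (.inr (.inr i)))) ≠ 0 := by simpa using hp i
        simp [hs, normalForm, hd, hq]
        field_simp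
    · rw [hz x y hxy]
      rcases x with j | i | i <;> rcases y with j' | i' | i' <;>
        simp [hs, normalForm] at hxy ⊢
      · exact diagonal_apply_ne' _ hxy
      · exact one_apply_ne' hxy
      · exact diagonal_apply_ne' _ hxy
  set Q := diagonal (d ∘ e.symm) * U with hQ
  have hQu : IsUnit Q.det := by
    rw [hQ, det_mul, det_diagonal]
    exact ((Finset.prod_ne_zero_iff.2 fun x _ => hd0 _).isUnit).mul
      ((isUnit_iff_isUnit_det U).1 hU)
  refine ⟨Q⁻¹, by rwa [isUnit_nonsing_inv_iff, isUnit_iff_isUnit_det], ?_⟩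
  have hQ2 : (Q.map τ)ᵀ * (Q⁻¹.map τ)ᵀ = 1 := by
    rw [← transpose_mul, ← Matrix.map_mul, nonsing_inv_mul _ hQu]
    simp
  rw [key]
  calc A = (Q⁻¹ * Q) * A * ((Q.map τ)ᵀ * (Q⁻¹.map τ)ᵀ) := by
        rw [nonsing_inv_mul _ hQu, hQ2, Matrix.one_mul, Matrix.mul_one]
    _ = _ := by simp only [Matrix.mul_assoc]

/-! ### Topology of the set of matrices with separable pencil -/

/-- `A` is nonsingular and the roots of its pencil are simple. -/
def IsSep (τ : ℂ →+* ℂ) {n : ℕ} (A : SqMat n) : Prop := A.det ≠ 0 ∧ (pencil τ A).Separable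

section Roots

variable {ι : Type*} [Fintype ι] {τ : ℂ →+* ℂ} {n : ℕ} {A : SqMat n}

/-- The pencil has degree n, so n distinct roots are all its roots and are simple. -/
theorem isSep_of_roots (hι : Fintype.card ι = n) (hA : A.det ≠ 0) {rt : ι → ℂ}
    (hinj : Function.Injective rt) (hroot : ∀ x, (pencil τ A).IsRoot (rt x)) :
    IsSep τ A ∧ ∀ z, (pencil τ A).IsRoot z → ∃ x, rt x = z := by
  classical
  have hp := pencil_ne_zero τ hA
  have hdeg : (pencil τ A).natDegree = n := by simpa using natDegree_pencil τ hA
  have hsub : Finset.univ.image rt ⊆ (pencil τ A).roots.toFinset := by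
    intro z hz
    obtain ⟨x, -, rfl⟩ := Finset.mem_image.1 hz
    rw [Multiset.mem_toFinset, mem_roots hp]
    exact hroot x
  have hcard : (Finset.univ.image rt).card = n := by
    rw [Finset.card_image_of_injective _ hinj, Finset.card_univ, hι]
  have h1 : (pencil τ A).roots.card ≤ n := (card_roots' _).trans_eq hdeg
  have h2 : (pencil τ A).roots.toFinset.card ≤ (pencil τ A).roots.card :=
    Multiset.toFinset_card_le _
  have h3 := Finset.card_le_card hsub
  have heq : Finset.univ.image rt = (pencil τ A).roots.toFinset :=
    Finset.eq_of_subset_of_card_le hsub (by omega)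
  refine ⟨⟨hA, ?_⟩, fun z hz => ?_⟩
  · rw [← nodup_roots_iff_of_splits hp (IsAlgClosed.splits _),
      ← Multiset.toFinset_card_eq_card_iff_nodup]
    omega
  · have hz' : z ∈ (pencil τ A).roots.toFinset := by
      rw [Multiset.mem_toFinset, mem_roots hp]; exact hz
    rw [← heq] at hz'
    simpa using hz'

theorem IsSep.card_roots (h : IsSep τ A) : (pencil τ A).roots.toFinset.card = n := by
  rw [Multiset.toFinset_card_of_nodup (nodup_roots h.2),
    ← (IsAlgClosed.splits (pencil τ A)).natDegree_eq_card_roots, natDegree_pencil τ h.1,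
    Fintype.card_fin]

theorem IsSep.exists_roots (h : IsSep τ A) :
    ∃ rt : Fin n → ℂ, Function.Injective rt ∧ ∀ x, (pencil τ A).IsRoot (rt x) := by
  refine ⟨fun i => ((pencil τ A).roots.toFinset.equivFinOfCardEq h.card_roots).symm i,
    fun i j hij => ?_, fun i => ?_⟩
  · exact (Equiv.injective _) (Subtype.ext hij)
  · have := (((pencil τ A).roots.toFinset.equivFinOfCardEq h.card_roots).symm i).2
    rw [Multiset.mem_toFinset, mem_roots (pencil_ne_zero τ h.1)] at this
    exact this

theorem eventually_det_ne_zero (hA : A.det ≠ 0) : ∀ᶠ S in 𝓝 A, S.det ≠ 0 :=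
  (continuous_id.matrix_det.continuousAt).eventually_ne hA

/-- If every root of the pencil of S has distance at least ε from z, the factorization bounds its
value at z below by ‖τ(det S)‖ εⁿ. At S = A the value is 0 and the bound positive, and both depend
continuously on S. -/
theorem eventually_exists_root_near (hτ : Continuous τ) (hA : A.det ≠ 0) {z : ℂ}
    (hz : (pencil τ A).IsRoot z) {ε : ℝ} (hε : 0 < ε) :
    ∀ᶠ S in 𝓝 A, ∃ w, (pencil τ S).IsRoot w ∧ dist w z < ε := by
  have hc : Continuous fun S : SqMat n => ‖(pencil τ S).eval z‖ - ‖τ S.det‖ * ε ^ n := by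
    simp only [eval_pencil]
    have h1 : Continuous fun S : SqMat n => (S - z • (S.map τ)ᵀ).det :=
      Continuous.matrix_det (continuous_id.sub
        ((continuous_id.matrix_map hτ).matrix_transpose.const_smul z))
    have h2 : Continuous fun S : SqMat n => S.det := continuous_id.matrix_det
    exact h1.norm.sub ((hτ.comp h2).norm.mul continuous_const)
  have hneg : ‖(pencil τ A).eval z‖ - ‖τ A.det‖ * ε ^ n < 0 := by
    rw [show (pencil τ A).eval z = 0 from hz, norm_zero, zero_sub, neg_lt_zero]
    have : 0 < ‖τ A.det‖ := norm_pos_iff.2 (by simpa using hA)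
    positivity
  filter_upwards [hc.continuousAt.eventually_lt continuousAt_const hneg,
    eventually_det_ne_zero hA] with S hS hdet
  by_contra! hcon
  refine absurd hS (not_lt.2 (sub_nonneg.2 ?_))
  have hsp := IsAlgClosed.splits (pencil τ S)
  have hdeg : (pencil τ S).natDegree = n := by simpa using natDegree_pencil τ hdet
  have hlc : ‖(pencil τ S).leadingCoeff‖ = ‖τ S.det‖ := by
    have := coeff_pencil_card τ S
    rw [Fintype.card_fin] at this
    rw [leadingCoeff, hdeg, this]
    simp
  rw [hsp.eval_eq_prod_roots, norm_mul, hlc]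
  refine mul_le_mul_of_nonneg_left ?_ (norm_nonneg _)
  have hcard : (pencil τ S).roots.card = n := by rw [← hsp.natDegree_eq_card_roots, hdeg]
  have key : ∀ s : Multiset ℂ, (∀ w ∈ s, ε ≤ dist w z) →
      ε ^ s.card ≤ ‖(s.map (z - ·)).prod‖ := by
    intro s
    induction s using Multiset.induction with
    | empty => simp
    | cons a s ih =>
      intro h
      rw [Multiset.card_cons, Multiset.map_cons, Multiset.prod_cons, norm_mul, pow_succ',
        ← dist_eq_norm, dist_comm]
      exact mul_le_mul (h a (Multiset.mem_cons_self a s))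
        (ih fun w hw => h w (Multiset.mem_cons_of_mem hw)) (by positivity) dist_nonneg
  have := key _ fun w hw => hcon w ((mem_roots (pencil_ne_zero τ hdet)).1 hw)
  rwa [hcard] at this

theorem eventually_exists_roots_mem (hτ : Continuous τ) (hA : A.det ≠ 0) {rt : ι → ℂ}
    (hroot : ∀ x, (pencil τ A).IsRoot (rt x)) {V : ι → Set ℂ} (hV : ∀ x, V x ∈ 𝓝 (rt x)) :
    ∀ᶠ S in 𝓝 A, S.det ≠ 0 ∧
      ∃ rt' : ι → ℂ, ∀ x, rt' x ∈ V x ∧ (pencil τ S).IsRoot (rt' x) := by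
  have h : ∀ᶠ S in 𝓝 A, ∀ x, ∃ w, w ∈ V x ∧ (pencil τ S).IsRoot w := by
    rw [eventually_all]
    intro x
    obtain ⟨ε, hε, hεV⟩ := Metric.mem_nhds_iff.1 (hV x)
    filter_upwards [eventually_exists_root_near hτ hA (hroot x) hε] with S ⟨w, hw, hd⟩
    exact ⟨w, hεV hd, hw⟩
  filter_upwards [h, eventually_det_ne_zero hA] with S hS hdet
  choose rt' h1 using hS
  exact ⟨hdet, rt', h1⟩

theorem exists_pairwise_disjoint_nhds {rt : ι → ℂ} (hinj : Function.Injective rt) :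
    ∃ V : ι → Set ℂ, (∀ x, V x ∈ 𝓝 (rt x)) ∧ Pairwise (Function.onFun Disjoint V) :=
  Pairwise.exists_mem_filter_of_disjoint fun _ _ hxy => disjoint_nhds_nhds.2 (hinj.ne hxy)

theorem injective_of_mem_disjoint {ι : Type*} {V : ι → Set ℂ} (hV : Pairwise (Function.onFun Disjoint V))
    {rt : ι → ℂ} (h : ∀ x, rt x ∈ V x) : Function.Injective rt := by
  intro x y hxy
  by_contra hne
  exact Set.disjoint_left.1 (hV hne) (h x) (hxy ▸ h y)

/-- Disjoint neighbourhoods of the n roots each keep a root, so the perturbed roots are still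
distinct. -/
theorem isOpen_isSep (hτ : Continuous τ) : IsOpen {A : SqMat n | IsSep τ A} := by
  rw [isOpen_iff_mem_nhds]
  intro A hA
  obtain ⟨rt, hinj, hroot⟩ := IsSep.exists_roots hA
  obtain ⟨V, hV, hdisj⟩ := exists_pairwise_disjoint_nhds hinj
  filter_upwards [eventually_exists_roots_mem hτ hA.1 hroot hV] with S ⟨hdet, rt', h⟩
  exact (isSep_of_roots (Fintype.card_fin n) hdet
    (injective_of_mem_disjoint hdisj fun x => (h x).1) fun x => (h x).2).1

end Roots

/-! ### Density -/

/-- The exceptional parameters are roots of one polynomial, the coefficient of degree n times the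
resultant of q and q', which is nonzero at z₀. -/
theorem finite_not_separable {q : ℂ[X][X]} {n : ℕ} (hn : n ≠ 0) (hq : q.natDegree ≤ n) {z₀ : ℂ}
    (h0 : (q.coeff n).eval z₀ ≠ 0) (hsep : (q.map (evalRingHom z₀)).Separable) :
    {z : ℂ | ¬ ((q.coeff n).eval z ≠ 0 ∧ (q.map (evalRingHom z)).Separable)}.Finite := by
  -- Fixing the formal degrees n and n - 1 makes the resultant commute with specialization; they are
  -- the true degrees wherever the coefficient of degree n survives.
  set R := resultant q (derivative q) n (n - 1) with hR
  have hdeg : ∀ z, (q.coeff n).eval z ≠ 0 → (q.map (evalRingHom z)).natDegree = n := by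
    intro z hz
    refine le_antisymm (natDegree_map_le.trans hq) (le_natDegree_of_ne_zero ?_)
    rw [coeff_map]; exact hz
  have hres : ∀ z, (q.coeff n).eval z ≠ 0 →
      R.eval z = resultant (q.map (evalRingHom z)) (derivative (q.map (evalRingHom z))) := by
    intro z hz
    rw [hdeg z hz, natDegree_derivative, hdeg z hz, derivative_map, resultant_map_map]
    rfl
  have hcop : ∀ z, (q.coeff n).eval z ≠ 0 →
      (R.eval z ≠ 0 ↔ (q.map (evalRingHom z)).Separable) := by
    intro z hz
    have hne : q.map (evalRingHom z) ≠ 0 := fun h => by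
      have := hdeg z hz
      rw [h, natDegree_zero] at this
      exact hn this.symm
    rw [hres z hz, Ne, resultant_eq_zero_iff, separable_def]
    simp [hne]
  have hR0 : q.coeff n * R ≠ 0 := by
    intro h
    have := congrArg (eval z₀) h
    rw [eval_mul, eval_zero, mul_eq_zero] at this
    exact this.elim h0 ((hcop z₀ h0).2 hsep)
  refine (finite_setOfPred_isRoot hR0).subset fun z hz => ?_
  by_contra hz'
  rw [Set.mem_ofPred_eq, IsRoot, eval_mul, mul_eq_zero, not_or] at hz'
  exact hz ⟨hz'.1, (hcop z hz'.1).1 hz'.2⟩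

/-- A polynomial in two variables that specializes to the pencils of the matrices on a line. -/
theorem exists_pencil_line {τ : ℂ →+* ℂ} (hτr : ∀ x : ℝ, τ x = x) {n : ℕ} (A D : SqMat n) :
    ∃ q : ℂ[X][X], q.natDegree ≤ n ∧
      ∀ s : ℝ, q.map (evalRingHom (s : ℂ)) = pencil τ (A + (s : ℂ) • D) := by
  -- The inner variable is the parameter of the line. Real values are fixed by τ, so the pencil
  -- depends polynomially on it even for the conjugation.
  let M : Matrix (Fin n) (Fin n) ℂ[X] := of fun i j => C (A i j) + X * C (D i j)
  let N : Matrix (Fin n) (Fin n) ℂ[X] := of fun i j => -(C (τ (A j i)) + X * C (τ (D j i)))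
  refine ⟨det ((X : ℂ[X][X]) • N.map C + M.map C), ?_, fun s => ?_⟩
  · simpa using natDegree_det_X_add_C_le N M
  · rw [← coe_mapRingHom, RingHom.map_det, pencil]
    congr 1
    ext1 i j
    simp only [RingHom.mapMatrix_apply, Matrix.map_apply, Matrix.add_apply, Matrix.smul_apply,
      smul_eq_mul, M, N, of_apply, pencilMat, coe_mapRingHom, Polynomial.map_add,
      Polynomial.map_mul, Polynomial.map_neg, map_X, map_C, coe_evalRingHom, eval_C, eval_X,
      map_add, map_mul, map_neg, hτr]
    ring

/-- The real line s ↦ A + s(B - A) is separable at s = 1, hence for all but finitely many s, and so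
for s arbitrarily close to 0. -/
theorem dense_isSep {τ : ℂ →+* ℂ} (hτr : ∀ x : ℝ, τ x = x) {n : ℕ} (hn : n ≠ 0) {B : SqMat n}
    (hB : IsSep τ B) : Dense {A : SqMat n | IsSep τ A} := by
  intro A
  obtain ⟨q, hqdeg, hqmap⟩ := exists_pencil_line hτr A (B - A)
  have hcoeff : ∀ s : ℝ, (q.coeff n).eval (s : ℂ) = (-1) ^ n * τ (A + (s : ℂ) • (B - A)).det := by
    intro s
    have := coeff_pencil_card τ (A + (s : ℂ) • (B - A))
    rw [← hqmap, Fintype.card_fin, coeff_map] at this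
    exact this
  have hfin := finite_not_separable hn hqdeg (z₀ := ((1 : ℝ) : ℂ))
    (by rw [hcoeff]; simpa using hB.1) (by rw [hqmap]; simpa using hB.2)
  have hfinR : {s : ℝ | ¬ IsSep τ (A + (s : ℂ) • (B - A))}.Finite := by
    refine (hfin.preimage (f := ((↑) : ℝ → ℂ)) Complex.ofReal_injective.injOn).subset fun s hs => ?_
    rw [Set.mem_preimage, Set.mem_ofPred_eq, hcoeff, hqmap]
    intro h
    exact hs ⟨by simpa using h.1, h.2⟩
  have hd : Dense {s : ℝ | ¬ IsSep τ (A + (s : ℂ) • (B - A))}ᶜ :=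
    hfinR.countable.dense_compl ℝ
  have hcont : Continuous fun s : ℝ => A + (s : ℂ) • (B - A) :=
    continuous_const.add (Complex.continuous_ofReal.smul continuous_const)
  have h0 : A = A + ((0 : ℝ) : ℂ) • (B - A) := by simp
  rw [h0]
  refine map_mem_closure (f := fun s : ℝ => A + (s : ℂ) • (B - A)) hcont (hd 0) fun s hs => ?_
  simpa using hs

/-- The topology on matrices is that of entrywise convergence, and the Frobenius norm dominates
every entry. -/
theorem exists_frobeniusBall_subset {n : ℕ} {U : Set (SqMat n)} (hU : IsOpen U) {A : SqMat n}
    (hA : A ∈ U) : ∃ ε > 0, frobeniusBall A ε ⊆ U := by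
  have hentry : ∀ (M : SqMat n) i j, ‖M i j‖ ≤ frobeniusNorm M := by
    intro M i j
    rw [frobeniusNorm, frobenius_norm_def, ← Real.sqrt_eq_rpow]
    refine Real.le_sqrt_of_sq_le ?_
    rw [← Real.rpow_natCast]
    refine le_trans ?_ (Finset.single_le_sum (f := fun i => ∑ j, ‖M i j‖ ^ (2 : ℝ))
      (fun i _ => by positivity) (Finset.mem_univ i))
    exact Finset.single_le_sum (f := fun j => ‖M i j‖ ^ (2 : ℝ))
      (fun j _ => by positivity) (Finset.mem_univ j)
  have hU' : U ∈ 𝓝 A := hU.mem_nhds hA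
  obtain ⟨ε, hε, h⟩ := (Metric.nhds_basis_ball (α := Fin n → Fin n → ℂ)).mem_iff.1 hU'
  refine ⟨ε, hε, fun S hS => h ?_⟩
  refine (dist_pi_lt_iff hε).2 fun i => ?_
  rw [dist_pi_lt_iff hε]
  intro j
  rw [dist_comm, dist_eq_norm]
  exact (hentry (A - S) i j).trans_lt hS

/-! ### Selecting one root from each pair `{z, (τ z)⁻¹}` -/

/-- `D` selects exactly one number from each two-element set `{z, (τ z)⁻¹}`. -/
structure IsSelector (τ : ℂ →+* ℂ) (D : ℂ → Prop) : Prop where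
  ne_zero : ∀ z, D z → z ≠ 0
  not_inv : ∀ z, D z → ¬ D (τ z)⁻¹
  not_fixed : ∀ z, D z → z * τ z ≠ 1
  cases : ∀ z, z ≠ 0 → D z ∨ D (τ z)⁻¹ ∨ z * τ z = 1

/-- `A` is nonsingular, and its pencil has the distinct roots `f_j` (`j < t`), which are fixed by
`z ↦ (τ z)⁻¹`, and `μ_i`, `(τ μ_i)⁻¹` (`i < r`), where the `μ_i` are selected by `D`. -/
def HasRootType (τ : ℂ →+* ℂ) (D : ℂ → Prop) (r t : ℕ) {n : ℕ} (A : SqMat n) : Prop :=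
  A.det ≠ 0 ∧ ∃ (f : Fin t → ℂ) (μ : Fin r → ℂ), Function.Injective (rootFun τ f μ) ∧
    (∀ i, D (μ i)) ∧ (∀ j, f j * τ (f j) = 1) ∧ ∀ x, (pencil τ A).IsRoot (rootFun τ f μ x)

section Selector

variable {τ : ℂ →+* ℂ} {D : ℂ → Prop} {r t n : ℕ} {A : SqMat n}

/-- Fixed numbers, selected numbers and partners of selected numbers are mutually exclusive, so a
collision can only occur within one family. -/
theorem IsSelector.rootFun_injective (hτ : ∀ z, τ (τ z) = z) (hD : IsSelector τ D)
    {f : Fin t → ℂ} {μ : Fin r → ℂ} (hf : Function.Injective f) (hμ : Function.Injective μ)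
    (hfix : ∀ j, f j * τ (f j) = 1) (hDμ : ∀ i, D (μ i)) :
    Function.Injective (rootFun τ f μ) := by
  have h1 : ∀ i, τ (μ i) ≠ 0 := fun i => by simpa using hD.ne_zero _ (hDμ i)
  have hfm : ∀ j i, f j ≠ μ i := fun j i h => hD.not_fixed _ (hDμ i) (h ▸ hfix j)
  have hfn : ∀ j i, f j ≠ (τ (μ i))⁻¹ := fun j i h => by
    have h2 := hfix j
    rw [h, map_inv₀, hτ, ← mul_inv, inv_eq_one, mul_comm] at h2
    exact hD.not_fixed _ (hDμ i) h2
  have hmn : ∀ i i', μ i ≠ (τ (μ i'))⁻¹ := fun i i' h => hD.not_inv _ (hDμ i') (h ▸ hDμ i)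
  rintro (j | i | i) (j' | i' | i') h <;> simp only [rootFun, Sum.elim_inl, Sum.elim_inr] at h
  · rw [hf h]
  · exact absurd h (hfm _ _)
  · exact absurd h (hfn _ _)
  · exact absurd h.symm (hfm _ _)
  · rw [hμ h]
  · exact absurd h (hmn _ _)
  · exact absurd h.symm (hfn _ _)
  · exact absurd h.symm (hmn _ _)
  · rw [hμ (τ.injective (inv_injective h))]

theorem card_rootIndex (h : t + (r + r) = n) :
    Fintype.card (Fin t ⊕ (Fin r ⊕ Fin r)) = n := by simpa using h

theorem HasRootType.isSep (hn : t + (r + r) = n) (h : HasRootType τ D r t A) : IsSep τ A := by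
  obtain ⟨hA, f, μ, hinj, -, -, hroot⟩ := h
  exact (isSep_of_roots (card_rootIndex hn) hA hinj hroot).1

theorem IsSep.exists_hasRootType (hτ : ∀ z, τ (τ z) = z) (hD : IsSelector τ D)
    (h : IsSep τ A) : ∃ r t, t + (r + r) = n ∧ HasRootType τ D r t A := by
  classical
  set R := (pencil τ A).roots.toFinset with hR
  have hmem : ∀ z, z ∈ R ↔ (pencil τ A).IsRoot z := fun z => by
    rw [hR, Multiset.mem_toFinset, mem_roots (pencil_ne_zero τ h.1)]
  set T := R.filter D with hT
  set F := R.filter fun z => z * τ z = 1 with hF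
  set f : Fin F.card → ℂ := fun j => F.equivFin.symm j with hf
  set μ : Fin T.card → ℂ := fun i => T.equivFin.symm i with hμ
  have hfF : ∀ j, f j ∈ F := fun j => (F.equivFin.symm j).2
  have hμT : ∀ i, μ i ∈ T := fun i => (T.equivFin.symm i).2
  have hFf : ∀ z ∈ F, ∃ j, f j = z := fun z hz => ⟨F.equivFin ⟨z, hz⟩, by simp [hf]⟩
  have hTμ : ∀ z ∈ T, ∃ i, μ i = z := fun z hz => ⟨T.equivFin ⟨z, hz⟩, by simp [hμ]⟩
  have hDμ : ∀ i, D (μ i) := fun i => (Finset.mem_filter.1 (hμT i)).2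
  have hfix : ∀ j, f j * τ (f j) = 1 := fun j => (Finset.mem_filter.1 (hfF j)).2
  have hinj : Function.Injective (rootFun τ f μ) := hD.rootFun_injective hτ
    (fun _ _ hij => F.equivFin.symm.injective (Subtype.ext hij))
    (fun _ _ hij => T.equivFin.symm.injective (Subtype.ext hij)) hfix hDμ
  have hroot : ∀ x, (pencil τ A).IsRoot (rootFun τ f μ x) := by
    rintro (j | i | i)
    · exact (hmem _).1 (Finset.mem_filter.1 (hfF j)).1
    · exact (hmem _).1 (Finset.mem_filter.1 (hμT i)).1
    · exact isRoot_pencil_inv hτ (hD.ne_zero _ (hDμ i))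
        ((hmem _).1 (Finset.mem_filter.1 (hμT i)).1)
  refine ⟨T.card, F.card, ?_, h.1, f, μ, hinj, hDμ, hfix, hroot⟩
  -- Every root is fixed, selected or the partner of a selected root; counting then gives t + 2r =
  -- n.
  have himg : Finset.univ.image (rootFun τ f μ) = R := by
    ext z
    rw [hmem, Finset.mem_image]
    constructor
    · rintro ⟨x, -, rfl⟩
      exact hroot x
    · intro hz
      have hz0 := ne_zero_of_isRoot_pencil h.1 hz
      rcases hD.cases z hz0 with h1 | h1 | h1
      · obtain ⟨i, hi⟩ := hTμ z (Finset.mem_filter.2 ⟨(hmem z).2 hz, h1⟩)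
        exact ⟨.inr (.inl i), Finset.mem_univ _, hi⟩
      · obtain ⟨i, hi⟩ := hTμ (τ z)⁻¹
          (Finset.mem_filter.2 ⟨(hmem _).2 (isRoot_pencil_inv hτ hz0 hz), h1⟩)
        refine ⟨.inr (.inr i), Finset.mem_univ _, ?_⟩
        simp [rootFun, hi, hτ]
      · obtain ⟨j, hj⟩ := hFf z (Finset.mem_filter.2 ⟨(hmem z).2 hz, h1⟩)
        exact ⟨.inl j, Finset.mem_univ _, hj⟩
  have hcard := congrArg Finset.card himg
  rw [Finset.card_image_of_injective _ hinj, h.card_roots, Finset.card_univ] at hcard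
  simpa using hcard

/-- The number t is recovered from A as the number of roots fixed by the involution. -/
theorem HasRootType.unique (hτ : ∀ z, τ (τ z) = z) (hD : IsSelector τ D) {r' t' : ℕ}
    (hn : t + (r + r) = n) (hn' : t' + (r' + r') = n) (h : HasRootType τ D r t A)
    (h' : HasRootType τ D r' t' A) : r = r' ∧ t = t' := by
  have key : ∀ {r t : ℕ}, t + (r + r) = n → HasRootType τ D r t A →
      {z | (pencil τ A).IsRoot z ∧ z * τ z = 1}.ncard = t := by
    rintro r t hn ⟨hA, f, μ, hinj, hDμ, hfix, hroot⟩
    have hf : Function.Injective f := hinj.comp Sum.inl_injective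
    have : {z | (pencil τ A).IsRoot z ∧ z * τ z = 1} = Set.range f := by
      ext z
      constructor
      · rintro ⟨hz, hz1⟩
        obtain ⟨x, rfl⟩ := (isSep_of_roots (card_rootIndex hn) hA hinj hroot).2 z hz
        rcases x with j | i | i
        · exact ⟨j, rfl⟩
        · exact absurd hz1 (hD.not_fixed _ (hDμ i))
        · refine absurd ?_ (hD.not_fixed _ (hDμ i))
          simp only [rootFun, Sum.elim_inr, map_inv₀, hτ] at hz1
          rwa [← mul_inv, inv_eq_one, mul_comm] at hz1
      · rintro ⟨j, rfl⟩
        exact ⟨hroot (.inl j), hfix j⟩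
    rw [this, ← Set.image_univ, Set.ncard_image_of_injective _ hf, Set.ncard_univ, Nat.card_fin]
  have h1 : t = t' := (key hn h).symm.trans (key hn' h')
  omega

/-- Selected roots stay selected because D is open. A root near a fixed one stays fixed: its partner
is a root in the same neighbourhood, which contains only one. -/
theorem isOpen_hasRootType (hτ : ∀ z, τ (τ z) = z) (hτc : Continuous τ) (hD : IsSelector τ D)
    (hDo : IsOpen {z | D z}) (hn : t + (r + r) = n) :
    IsOpen {A : SqMat n | HasRootType τ D r t A} := by
  rw [isOpen_iff_mem_nhds]
  rintro A ⟨hA, f, μ, hinj, hDμ, hfix, hroot⟩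
  obtain ⟨V, hV, hdisj⟩ := exists_pairwise_disjoint_nhds hinj
  have hf0 : ∀ j, τ (f j) ≠ 0 := fun j h => by have := hfix j; simp [h] at this
  -- Near a fixed root the partner is also required to stay in V; near a selected root, D is
  -- required.
  have hW : ∀ x, V x ∩ (Sum.elim (fun j => (fun z => (τ z)⁻¹) ⁻¹' V (.inl j))
      (fun y => (Sum.elim (fun _ => {z | D z}) (fun _ => Set.univ) y)) x : Set ℂ) ∈
        𝓝 (rootFun τ f μ x) := by
    intro x
    refine inter_mem (hV x) ?_
    rcases x with j | i | i
    · have hc : ContinuousAt (fun z => (τ z)⁻¹) (f j) := hτc.continuousAt.inv₀ (hf0 j)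
      refine hc.preimage_mem_nhds ?_
      rw [← eq_inv_of_mul_eq_one_left (hfix j)]
      exact hV (.inl j)
    · exact hDo.mem_nhds (hDμ i)
    · exact univ_mem
  filter_upwards [eventually_exists_roots_mem hτc hA hroot hW] with S ⟨hdet, rt, h⟩
  have hrtinj : Function.Injective rt :=
    injective_of_mem_disjoint hdisj fun x => (h x).1.1
  have hall := (isSep_of_roots (card_rootIndex hn) hdet hrtinj fun x => (h x).2).2
  have hfix' : ∀ j, rt (.inl j) * τ (rt (.inl j)) = 1 := by
    intro j
    have h0 := ne_zero_of_isRoot_pencil hdet (h (.inl j)).2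
    obtain ⟨y, hy⟩ := hall _ (isRoot_pencil_inv hτ h0 (h (.inl j)).2)
    have h1 : rt y ∈ V (.inl j) := by rw [hy]; exact (h (.inl j)).1.2
    have h2 : y = .inl j := by
      by_contra hne
      exact Set.disjoint_left.1 (hdisj hne) (h y).1.1 h1
    rw [h2] at hy
    have h3 : τ (rt (.inl j)) ≠ 0 := by simpa using h0
    nth_rw 1 [hy]
    exact inv_mul_cancel₀ h3
  have hD' : ∀ i, D (rt (.inr (.inl i))) := fun i => (h (.inr (.inl i))).1.2
  -- The third family is taken to be the exact partners of the second, not the perturbed roots found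
  -- there.
  refine ⟨hdet, fun j => rt (.inl j), fun i => rt (.inr (.inl i)),
    hD.rootFun_injective hτ (hrtinj.comp Sum.inl_injective)
      (hrtinj.comp (Sum.inr_injective.comp Sum.inl_injective)) hfix' hD', hD', hfix', ?_⟩
  rintro (j | i | i)
  · exact (h _).2
  · exact (h _).2
  · exact isRoot_pencil_inv hτ (hD.ne_zero _ (hD' i)) (h _).2

end Selector

/-! ### Pencils of direct sums of blocks of the smallest size -/

theorem prod_pencil_blocks (τ : ℂ →+* ℂ) {t r : ℕ} {l : Fin t → ℕ} {m : Fin r → ℕ}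
    (hl : ∀ j, l j = 1) (hm : ∀ i, m i = 1) {α : Fin t → ℂ} {μ : Fin r → ℂ}
    (hα : ∀ j, α j ≠ 0) (hμ : ∀ i, μ i ≠ 0) : ∃ c : ℂ, c ≠ 0 ∧
      (∏ j, pencil τ (α j • gammaBlk (l j))) * ∏ i, pencil τ (hBlk (m i) (μ i)) =
        C c * ∏ x, (X - C (rootFun τ (fun j => α j / τ (α j)) μ x)) := by
  have h1 : ∀ j, ∃ c : ℂ, c ≠ 0 ∧
      pencil τ (α j • gammaBlk (l j)) = C c * (X - C (α j / τ (α j))) := by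
    intro j
    have h0 : τ (α j) ≠ 0 := by simpa using hα j
    obtain ⟨c, hc, h⟩ := pencil_smul_gammaBlk τ (l j) (α j)
    refine ⟨c * -τ (α j), mul_ne_zero hc (neg_ne_zero.2 h0), ?_⟩
    rw [h, hl]
    have : C (τ (α j)) * C (α j / τ (α j)) = C (α j) := by
      rw [← C_mul, mul_div_cancel₀ _ h0]
    have h2 : α j * (-1) ^ (1 + 1) = α j := by ring
    simp only [h2, C_mul, C_neg]
    linear_combination (-C c) * this
  have h2 : ∀ i, ∃ c : ℂ, c ≠ 0 ∧
      pencil τ (hBlk (m i) (μ i)) = C c * ((X - C (μ i)) * (X - C (τ (μ i))⁻¹)) := by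
    intro i
    have h0 : τ (μ i) ≠ 0 := by simpa using hμ i
    obtain ⟨c, hc, h⟩ := pencil_hBlk τ (m i) (μ i)
    refine ⟨c * τ (μ i), mul_ne_zero hc h0, ?_⟩
    rw [h, hm]
    have : C (τ (μ i)) * C (τ (μ i))⁻¹ = 1 := by
      rw [← C_mul, mul_inv_cancel₀ h0, C_1]
    simp only [C_mul]
    linear_combination (C c * (X - C (μ i))) * this
  choose a ha h1 using h1
  choose b hb h2 using h2
  refine ⟨(∏ j, a j) * ∏ i, b i, mul_ne_zero (Finset.prod_ne_zero_iff.2 fun j _ => ha j)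
    (Finset.prod_ne_zero_iff.2 fun i _ => hb i), ?_⟩
  simp only [h1, h2, Finset.prod_mul_distrib, Fintype.prod_sum_type, rootFun, Sum.elim_inl,
    Sum.elim_inr, C_mul, map_prod]
  ring

theorem isSep_iff_injective {τ : ℂ →+* ℂ} {n : ℕ} {A : SqMat n} {ι : Type*} [Fintype ι]
    {rt : ι → ℂ} (hrt : ∀ x, rt x ≠ 0) {c : ℂ} (hc : c ≠ 0)
    (h : pencil τ A = C c * ∏ x, (X - C (rt x))) : IsSep τ A ↔ Function.Injective rt := by
  have h0 : A.det ≠ 0 := by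
    rw [← eval_zero_pencil τ, h, eval_mul, eval_C, eval_prod]
    exact mul_ne_zero hc (Finset.prod_ne_zero_iff.2 fun x _ => by simpa using hrt x)
  rw [IsSep, h, and_iff_right h0, ← separable_prod_X_sub_C_iff]
  exact ⟨Separable.of_mul_right, Separable.unit_mul (isUnit_C.2 hc.isUnit)⟩

theorem isRoot_pencil_of_eq {τ : ℂ →+* ℂ} {n : ℕ} {A : SqMat n} {ι : Type*} [Fintype ι]
    {rt : ι → ℂ} {c : ℂ} (h : pencil τ A = C c * ∏ x, (X - C (rt x))) (x : ι) :
    (pencil τ A).IsRoot (rt x) := by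
  rw [IsRoot, h, eval_mul, eval_prod, Finset.prod_eq_zero (Finset.mem_univ x) (by simp), mul_zero]

theorem rootFun_ne_zero {τ : ℂ →+* ℂ} {t r : ℕ} {f : Fin t → ℂ} {μ : Fin r → ℂ}
    (hf : ∀ j, f j ≠ 0) (hμ : ∀ i, μ i ≠ 0) (x : Fin t ⊕ (Fin r ⊕ Fin r)) :
    rootFun τ f μ x ≠ 0 := by
  rcases x with j | i | i
  · exact hf j
  · exact hμ i
  · simpa [rootFun] using hμ i

/-- The pencil is a constant times the l-th power of a nonunit, which is separable only for l = 1.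
-/
theorem gammaBlk_size_eq_one {τ : ℂ →+* ℂ} {l : ℕ} {a : ℂ} (ha : a ≠ 0) (hl : 1 ≤ l)
    (h : (pencil τ (a • gammaBlk l)).Separable) : l = 1 := by
  obtain ⟨c, hc, h1⟩ := pencil_smul_gammaBlk τ l a
  rw [h1] at h
  refine (Separable.of_pow ?_ (by omega) h.of_mul_right).2
  intro hu
  have hdeg := natDegree_eq_zero_of_isUnit hu
  have h2 : (C (a * (-1) ^ (l + 1)) - X * C (τ a)).coeff 1 = -τ a := by
    rw [coeff_sub, coeff_C_of_ne_zero one_ne_zero, coeff_X_mul, coeff_C_zero, zero_sub]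
  have h3 := le_natDegree_of_ne_zero (p := C (a * (-1) ^ (l + 1)) - X * C (τ a)) (n := 1)
    (by rw [h2]; simpa using ha)
  omega

/-- Both linear factors occur to the power k, and they are proportional if μ τ(μ) = 1. The second
conclusion serves to exclude the blocks H_{2p}((-1)^p). -/
theorem hBlk_size_eq_one {τ : ℂ →+* ℂ} {k : ℕ} {μ : ℂ} (hk : 1 ≤ k)
    (h : (pencil τ (hBlk k μ)).Separable) : k = 1 ∧ μ * τ μ ≠ 1 := by
  obtain ⟨c, hc, h1⟩ := pencil_hBlk τ k μ
  rw [h1, mul_pow] at h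
  have hnu : ∀ z : ℂ, ¬ IsUnit (C z - X) := fun z hu => by
    rw [← neg_sub, IsUnit.neg_iff] at hu
    exact not_isUnit_X_sub_C z hu
  have hk1 : k = 1 := (Separable.of_pow (hnu μ) (by omega) h.of_mul_right.of_mul_right).2
  refine ⟨hk1, fun hμ => ?_⟩
  have h2 := h.of_mul_right
  have h3 : (1 - X * C (τ μ)) = C (τ μ) * (C μ - X) := by
    rw [mul_sub, ← C_mul, mul_comm (τ μ), hμ, C_1]; ring
  rw [hk1, pow_one, pow_one, h3, mul_assoc] at h2
  have h4 := h2.of_mul_right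
  rw [← pow_two] at h4
  have := (Separable.of_pow (hnu μ) (by norm_num) h4).2
  norm_num at this

/-! ### Invariance under congruence -/

theorem TwistedCongruent.isSep {τ : ℂ →+* ℂ} (hτ : ∀ z, τ (τ z) = z) {n : ℕ} {A B : SqMat n}
    (h : TwistedCongruent τ A B) : IsSep τ A ↔ IsSep τ B := by
  obtain ⟨c, hc, hp⟩ := h.pencil_eq hτ
  have hdet : A.det = c * B.det := by
    rw [← eval_zero_pencil τ, ← eval_zero_pencil τ, hp, eval_mul, eval_C]
  rw [IsSep, IsSep, hp, hdet]
  refine and_congr (by simp [hc])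
    ⟨Separable.of_mul_right, Separable.unit_mul (isUnit_C.2 hc.isUnit)⟩

theorem TwistedCongruent.hasRootType {τ : ℂ →+* ℂ} (hτ : ∀ z, τ (τ z) = z) {D : ℂ → Prop}
    {r t n : ℕ} {A B : SqMat n} (h : TwistedCongruent τ A B) :
    HasRootType τ D r t A ↔ HasRootType τ D r t B := by
  obtain ⟨c, hc, hp⟩ := h.pencil_eq hτ
  have hdet : A.det = c * B.det := by
    rw [← eval_zero_pencil τ, ← eval_zero_pencil τ, hp, eval_mul, eval_C]
  have hr : ∀ z, (pencil τ A).IsRoot z ↔ (pencil τ B).IsRoot z := fun z => by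
    rw [hp, IsRoot, IsRoot, eval_mul, eval_C]; simp [hc]
  simp only [HasRootType, hr, hdet]
  simp [hc]

theorem hasRootType_of_pencil {τ : ℂ →+* ℂ} (hτ : ∀ z, τ (τ z) = z) {D : ℂ → Prop}
    (hD : IsSelector τ D) {r t n : ℕ} {A : SqMat n} {α : Fin t → ℂ} {μ : Fin r → ℂ}
    (hα : ∀ j, α j ≠ 0) (hf : Function.Injective fun j => α j / τ (α j))
    (hμ : Function.Injective μ) (hDμ : ∀ i, D (μ i)) {c : ℂ} (hc : c ≠ 0)
    (h : pencil τ A = C c * ∏ x, (X - C (rootFun τ (fun j => α j / τ (α j)) μ x))) :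
    HasRootType τ D r t A := by
  have h0 : ∀ j, τ (α j) ≠ 0 := fun j => by simpa using hα j
  have hfix : ∀ j, α j / τ (α j) * τ (α j / τ (α j)) = 1 := fun j => by
    have := hα j
    have := h0 j
    rw [map_div₀, hτ]
    field_simp
  have hinj := hD.rootFun_injective hτ hf hμ hfix hDμ
  exact ⟨((isSep_iff_injective (rootFun_ne_zero (fun j => div_ne_zero (hα j) (h0 j))
    fun i => hD.ne_zero _ (hDμ i)) hc h).2 hinj).1, _, μ, hinj, hDμ, hfix, isRoot_pencil_of_eq h⟩

theorem congruent_iff {n : ℕ} {A B : SqMat n} :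
    Congruent A B ↔ TwistedCongruent (RingHom.id ℂ) A B := by
  simp [Congruent, TwistedCongruent]

theorem starCongruent_iff {n : ℕ} {A B : SqMat n} :
    StarCongruent A B ↔ TwistedCongruent (starRingEnd ℂ) A B := Iff.rfl

/-! ### The selectors for congruence and `*`congruence -/

theorem isTypeIIa_iff {z : ℂ} : IsTypeIIa z ↔ 1 < ‖z‖ ∨ (‖z‖ = 1 ∧ 0 < z.im) := by
  refine or_congr Iff.rfl ⟨?_, ?_⟩
  · rintro ⟨θ, h0, h1, rfl⟩
    rw [Complex.norm_exp_ofReal_mul_I, Complex.exp_ofReal_mul_I_im]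
    exact ⟨rfl, Real.sin_pos_of_pos_of_lt_pi h0 h1⟩
  · rintro ⟨h1, h2⟩
    refine ⟨z.arg, lt_of_le_of_ne (Complex.arg_nonneg_iff.2 h2.le) fun h => ?_,
      lt_of_le_of_ne (Complex.arg_le_pi z) fun h => ?_, ?_⟩
    · exact h2.ne' (Complex.arg_eq_zero_iff.1 h.symm).2
    · exact h2.ne' (Complex.arg_eq_pi_iff.1 h).2
    · have := Complex.norm_mul_exp_arg_mul_I z
      rw [h1] at this
      simpa using this.symm

/-- Inversion exchanges the inside and outside of the unit circle and flips the sign of the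
imaginary part on it; only 1 and -1 are fixed. -/
theorem isSelector_isTypeIIa : IsSelector (RingHom.id ℂ) IsTypeIIa where
  ne_zero z hz := by
    rintro rfl
    rw [isTypeIIa_iff] at hz
    norm_num at hz
  not_inv z hz hz' := by
    rw [isTypeIIa_iff] at hz hz'
    rw [RingHom.id_apply, norm_inv, Complex.inv_im] at hz'
    rcases hz with hz | ⟨hz, him⟩
    · have := inv_lt_one_of_one_lt₀ hz
      rcases hz' with h | h
      · linarith
      · linarith [h.1]
    · rw [Complex.normSq_eq_norm_sq, hz] at hz'
      norm_num at hz'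
      linarith
  not_fixed z hz h := by
    rw [isTypeIIa_iff] at hz
    rcases mul_self_eq_one_iff.1 h with rfl | rfl <;> norm_num at hz
  cases z hz := by
    simp only [isTypeIIa_iff, RingHom.id_apply, norm_inv, Complex.inv_im]
    have hpos : 0 < ‖z‖ := norm_pos_iff.2 hz
    rcases lt_trichotomy ‖z‖ 1 with h | h | h
    · exact Or.inr (Or.inl (Or.inl ((one_lt_inv₀ hpos).2 h)))
    · rw [Complex.normSq_eq_norm_sq, h]
      rcases lt_trichotomy z.im 0 with h' | h' | h'
      · right; left; right
        norm_num
        exact h'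
      · right; right
        have h2 : z.re * z.re = 1 := by
          have := Complex.normSq_eq_norm_sq z
          rw [h, Complex.normSq_apply, h'] at this
          simpa using this
        apply Complex.ext <;> simp [h', h2]
      · left; right
        exact ⟨rfl, h'⟩
    · exact Or.inl (Or.inl h)

theorem mul_conj_eq_one_iff {z : ℂ} : z * starRingEnd ℂ z = 1 ↔ ‖z‖ = 1 := by
  rw [Complex.mul_conj']
  norm_cast
  exact pow_eq_one_iff_of_nonneg (norm_nonneg z) two_ne_zero

/-- Here the involution is reflection in the unit circle, which fixes exactly the circle. -/
theorem isSelector_one_lt_norm : IsSelector (starRingEnd ℂ) fun z => 1 < ‖z‖ where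
  ne_zero z hz := by
    rintro rfl
    norm_num at hz
  not_inv z hz := by
    rw [norm_inv, RCLike.norm_conj, not_lt]
    exact (inv_lt_one_of_one_lt₀ hz).le
  not_fixed z hz h := hz.ne' (mul_conj_eq_one_iff.1 h)
  cases z hz := by
    rw [norm_inv, RCLike.norm_conj, mul_conj_eq_one_iff]
    have hpos : 0 < ‖z‖ := norm_pos_iff.2 hz
    rcases lt_trichotomy ‖z‖ 1 with h | h | h
    · exact Or.inr (Or.inl ((one_lt_inv₀ hpos).2 h))
    · exact Or.inr (Or.inr h)
    · exact Or.inl h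

/-- The left side is the root contributed by α Γ_1; this is why the bundle conditions concern α². -/
theorem div_conj_eq_sq {a : ℂ} (ha : ‖a‖ = 1) : a / starRingEnd ℂ a = a ^ 2 := by
  have h := mul_conj_eq_one_iff.2 ha
  have h0 : starRingEnd ℂ a ≠ 0 := fun h0 => by simp [h0] at h
  rw [div_eq_iff h0, pow_two, mul_assoc, h, mul_one]

/-! ### The canonical forms with blocks of the smallest size -/

theorem dirSum_apply {p q : ℕ} (A : SqMat p) (B : SqMat q) (x y : Fin p ⊕ Fin q) :
    dirSum A B (finSumFinEquiv x) (finSumFinEquiv y) = fromBlocks A 0 0 B x y := by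
  simp only [dirSum, reindex_apply, submatrix_apply, Equiv.symm_apply_apply]

theorem bigDirSum_apply {r : ℕ} {k : Fin r → ℕ} (A : ∀ i, SqMat (k i)) (x y : Σ i, Fin (k i)) :
    bigDirSum A (finSigmaFinEquiv x) (finSigmaFinEquiv y) = blockDiagonal' A x y := by
  simp only [bigDirSum, reindex_apply, submatrix_apply, Equiv.symm_apply_apply]

theorem hBlk_apply (k : ℕ) (μ : ℂ) (x y : Fin k ⊕ Fin k) :
    hBlk k μ (finSumFinEquiv x) (finSumFinEquiv y) = fromBlocks 0 1 (jordanBlk k μ) 0 x y := by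
  simp only [hBlk, reindex_apply, submatrix_apply, Equiv.symm_apply_apply]

/-- The position of the entries of `normalForm` in the direct sum of the blocks `α_j Γ_1`. -/
def gammaIndex {t : ℕ} (j : Fin t) : Fin (∑ _j : Fin t, 1) := finSigmaFinEquiv ⟨j, 0⟩

/-- The position of the entries of `normalForm` in the direct sum of the blocks `H_2(μ_i)`. -/
def hIndex {r : ℕ} (x : Fin r ⊕ Fin r) : Fin (∑ _i : Fin r, (1 + 1)) :=
  finSigmaFinEquiv (Sum.elim (fun i => ⟨i, finSumFinEquiv (.inl 0)⟩)
    (fun i => ⟨i, finSumFinEquiv (.inr 0)⟩) x)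

theorem gammaIndex_injective {t : ℕ} : Function.Injective (gammaIndex (t := t)) := by
  intro i j h
  exact congrArg Sigma.fst (finSigmaFinEquiv.injective h)

theorem hIndex_injective {r : ℕ} : Function.Injective (hIndex (r := r)) := by
  intro x y h
  replace h := finSigmaFinEquiv.injective h
  rcases x with i | i <;> rcases y with j | j <;>
    simp only [Sum.elim_inl, Sum.elim_inr, Sigma.mk.injEq] at h
  · rw [h.1]
  · obtain ⟨rfl, h⟩ := h
    have := finSumFinEquiv.injective (eq_of_heq h)
    simp at this
  · obtain ⟨rfl, h⟩ := h
    have := finSumFinEquiv.injective (eq_of_heq h)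
    simp at this
  · rw [h.1]

theorem bigDirSum_gamma_apply {t : ℕ} (α : Fin t → ℂ) (i j : Fin t) :
    bigDirSum (fun j => α j • gammaBlk 1) (gammaIndex i) (gammaIndex j) = diagonal α i j := by
  rw [gammaIndex, gammaIndex, bigDirSum_apply]
  by_cases h : i = j
  · subst h
    rw [blockDiagonal'_apply_eq, diagonal_apply_eq]
    simp [gammaBlk]
  · rw [blockDiagonal'_apply_ne _ _ _ h, diagonal_apply_ne _ h]

theorem bigDirSum_hBlk_apply {r : ℕ} (μ : Fin r → ℂ) (x y : Fin r ⊕ Fin r) :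
    bigDirSum (fun i => hBlk 1 (μ i)) (hIndex x) (hIndex y) =
      fromBlocks 0 1 (diagonal μ) 0 x y := by
  rw [hIndex, hIndex, bigDirSum_apply]
  rcases x with i | i <;> rcases y with j | j <;> by_cases h : i = j
  all_goals
    first
    | subst h
      simp only [Sum.elim_inl, Sum.elim_inr, blockDiagonal'_apply_eq, hBlk_apply]
      simp [jordanBlk]
    | simp only [Sum.elim_inl, Sum.elim_inr, blockDiagonal'_apply_ne _ _ _ h]
      simp [h]

/-- Z stands for the empty sum of Jordan blocks. The bijection must not depend on α, since the
reduction to normal form computes α only after the bijection is chosen. -/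
theorem exists_dirSum_eq_normalForm {z : ℕ} (hz : z = 0) (Z : SqMat z) (t r : ℕ) :
    ∃ e : Fin t ⊕ (Fin r ⊕ Fin r) ≃ Fin (z + (∑ _j : Fin t, 1) + ∑ _i : Fin r, (1 + 1)),
      ∀ (α : Fin t → ℂ) (μ : Fin r → ℂ),
        dirSum (dirSum Z (bigDirSum fun j => α j • gammaBlk 1)) (bigDirSum fun i => hBlk 1 (μ i)) =
          reindex e e (normalForm α μ) := by
  let E : Fin t ⊕ (Fin r ⊕ Fin r) → Fin (z + (∑ _j : Fin t, 1) + ∑ _i : Fin r, (1 + 1)) :=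
    fun x => finSumFinEquiv (Sum.elim (fun j => .inl (finSumFinEquiv (.inr (gammaIndex j))))
        (fun y => .inr (hIndex y)) x)
  have hE : Function.Injective E := by
    intro x y h
    replace h := finSumFinEquiv.injective h
    rcases x with x | x <;> rcases y with y | y <;>
      simp only [Sum.elim_inl, Sum.elim_inr, reduceCtorEq] at h
    · rw [gammaIndex_injective (Sum.inr_injective (finSumFinEquiv.injective
        (Sum.inl_injective h)))]
    · rw [hIndex_injective (Sum.inr_injective h)]
  have hbij : Function.Bijective E := (Fintype.bijective_iff_injective_and_card E).2
    ⟨hE, by simp [hz]; omega⟩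
  refine ⟨Equiv.ofBijective E hbij, fun α μ => ?_⟩
  rw [eq_comm, ← Equiv.eq_symm_apply]
  ext x y
  change _ = dirSum _ _ (E x) (E y)
  simp only [E, dirSum_apply]
  rcases x with x | x <;> rcases y with y | y
  · simp only [normalForm, fromBlocks_apply₁₁, Sum.elim_inl, dirSum_apply, fromBlocks_apply₂₂,
      bigDirSum_gamma_apply]
  · simp [normalForm]
  · simp [normalForm]
  · simp only [normalForm, fromBlocks_apply₂₂, Sum.elim_inr, bigDirSum_hBlk_apply]

theorem exists_dirSum_eq_reindex {p w : ℕ} (hw : w = 0) (W : SqMat w) :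
    ∃ e : Fin p ≃ Fin (p + w), ∀ A : SqMat p, dirSum A W = reindex e e A := by
  have hbij : Function.Bijective fun i : Fin p => finSumFinEquiv (n := w) (.inl i) :=
    (Fintype.bijective_iff_injective_and_card _).2
      ⟨finSumFinEquiv.injective.comp Sum.inl_injective, by simp [hw]⟩
  refine ⟨Equiv.ofBijective _ hbij, fun A => ?_⟩
  rw [eq_comm, ← Equiv.eq_symm_apply]
  ext x y
  change _ = dirSum A W (finSumFinEquiv (.inl x)) (finSumFinEquiv (.inl y))
  rw [dirSum_apply, fromBlocks_apply₁₁]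

/-- The shape of the generic canonical form for congruence. -/
def genericShape (n : ℕ) : CFCShape n where
  n₁ := 0
  n₂ := n % 2
  n₃ := n / 2
  n₄ := 0
  k _ := 1
  l _ := 1
  m _ := 1
  p _ := 1
  k_pos _ := le_rfl
  l_pos _ := le_rfl
  m_pos _ := le_rfl
  p_pos _ := le_rfl
  size_eq := by simp; omega

/-- The shape of a generic canonical form for `*`congruence. -/
def genericStarShape {n ℓ : ℕ} (hℓ : ℓ ≤ n / 2) : StarCFCShape n where
  n₁ := 0
  n₂ := n - 2 * ℓ
  n₃ := ℓ
  k _ := 1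
  l _ := 1
  m _ := 1
  k_pos _ := le_rfl
  l_pos _ := le_rfl
  m_pos _ := le_rfl
  size_eq := by simp; omega

theorem genericShape_form (n : ℕ) :
    ∃ e : Fin (n % 2) ⊕ (Fin (n / 2) ⊕ Fin (n / 2)) ≃ Fin n, ∀ μ : Fin (n / 2) → ℂ,
      (genericShape n).form μ = reindex e e (normalForm (fun _ => 1) μ) := by
  obtain ⟨e₁, h₁⟩ := exists_dirSum_eq_normalForm (z := ∑ _j : Fin 0, 1) rfl
    (bigDirSum fun _ : Fin 0 => jordanBlk 1 0) (n % 2) (n / 2)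
  obtain ⟨e₂, h₂⟩ := exists_dirSum_eq_reindex
    (p := (∑ _j : Fin 0, 1) + (∑ _j : Fin (n % 2), 1) + ∑ _i : Fin (n / 2), (1 + 1))
    (w := ∑ _j : Fin 0, (1 + 1)) rfl (bigDirSum fun _ : Fin 0 => hBlk 1 ((-1) ^ 1))
  refine ⟨e₁.trans (e₂.trans (finCongr (genericShape n).size_eq)), fun μ => ?_⟩
  have h := h₁ (fun _ => 1) μ
  simp only [one_smul] at h
  exact congrArg (resize (genericShape n).size_eq)
    ((h₂ _).trans (congrArg (reindex e₂ e₂) h))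

theorem genericStarShape_form {n ℓ : ℕ} (hℓ : ℓ ≤ n / 2) :
    ∃ e : Fin (n - 2 * ℓ) ⊕ (Fin ℓ ⊕ Fin ℓ) ≃ Fin n,
      ∀ (α : Fin (n - 2 * ℓ) → ℂ) (μ : Fin ℓ → ℂ),
        (genericStarShape hℓ).form α μ = reindex e e (normalForm α μ) := by
  obtain ⟨e₁, h₁⟩ := exists_dirSum_eq_normalForm (z := ∑ _j : Fin 0, 1) rfl
    (bigDirSum fun _ : Fin 0 => jordanBlk 1 0) (n - 2 * ℓ) ℓ
  refine ⟨e₁.trans (finCongr (genericStarShape hℓ).size_eq), fun α μ => ?_⟩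
  exact congrArg (resize (genericStarShape hℓ).size_eq) (h₁ α μ)

/-! ### The generic bundle for congruence -/

theorem pencil_CFC_form (τ : ℂ →+* ℂ) {n : ℕ} (s : CFCShape n) (μ : Fin s.n₃ → ℂ) :
    pencil τ (s.form μ) = (∏ j, pencil τ (jordanBlk (s.k j) 0)) *
      (∏ j, pencil τ ((1 : ℂ) • gammaBlk (s.l j))) * (∏ j, pencil τ (hBlk (s.m j) (μ j))) *
      ∏ j, pencil τ (hBlk (s.p j) ((-1) ^ s.p j)) := by
  simp only [CFCShape.form, pencil_resize, pencil_dirSum, pencil_bigDirSum, one_smul]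

theorem pencil_starCFC_form (τ : ℂ →+* ℂ) {n : ℕ} (s : StarCFCShape n) (α : Fin s.n₂ → ℂ)
    (μ : Fin s.n₃ → ℂ) :
    pencil τ (s.form α μ) = (∏ j, pencil τ (jordanBlk (s.k j) 0)) *
      (∏ j, pencil τ (α j • gammaBlk (s.l j))) * ∏ j, pencil τ (hBlk (s.m j) (μ j)) := by
  simp only [StarCFCShape.form, pencil_resize, pencil_dirSum, pencil_bigDirSum]

theorem not_isSep_of_jordanBlk {τ : ℂ →+* ℂ} {n : ℕ} {A : SqMat n} {k : ℕ} (hk : 1 ≤ k)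
    (h : pencil τ (jordanBlk k 0) ∣ pencil τ A) : ¬ IsSep τ A := by
  rintro ⟨hA, -⟩
  obtain ⟨q, hq⟩ := h
  rw [← eval_zero_pencil τ, hq, eval_mul, eval_zero_pencil, det_jordanBlk_zero hk, zero_mul] at hA
  exact hA rfl

theorem CFCShape.blocks_of_isSep {n : ℕ} {s : CFCShape n} {μ : Fin s.n₃ → ℂ}
    (h : IsSep (RingHom.id ℂ) (s.form μ)) :
    IsEmpty (Fin s.n₁) ∧ (∀ j, s.l j = 1) ∧ (∀ j, s.m j = 1) ∧ IsEmpty (Fin s.n₄) := by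
  have hp := pencil_CFC_form (RingHom.id ℂ) s μ
  refine ⟨⟨fun j => ?_⟩, fun j => ?_, fun j => ?_, ⟨fun j => ?_⟩⟩
  · refine not_isSep_of_jordanBlk (s.k_pos j) ?_ h
    rw [hp, mul_assoc, mul_assoc]
    exact (Finset.dvd_prod_of_mem _ (Finset.mem_univ j)).mul_right _
  · refine gammaBlk_size_eq_one (τ := RingHom.id ℂ) one_ne_zero (s.l_pos j) (h.2.of_dvd ?_)
    rw [hp, mul_assoc, mul_assoc]
    exact ((Finset.dvd_prod_of_mem (fun j => pencil (RingHom.id ℂ) ((1 : ℂ) • gammaBlk (s.l j)))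
      (Finset.mem_univ j)).mul_right _).mul_left _
  · refine (hBlk_size_eq_one (τ := RingHom.id ℂ) (μ := μ j) (s.m_pos j) (h.2.of_dvd ?_)).1
    rw [hp]
    exact ((Finset.dvd_prod_of_mem (fun j => pencil (RingHom.id ℂ) (hBlk (s.m j) (μ j)))
      (Finset.mem_univ j)).mul_left _).mul_right _
  · refine (hBlk_size_eq_one (τ := RingHom.id ℂ) (μ := (-1) ^ s.p j) (s.p_pos j)
      (h.2.of_dvd ?_)).2 ?_
    · rw [hp]
      exact (Finset.dvd_prod_of_mem
        (fun j => pencil (RingHom.id ℂ) (hBlk (s.p j) ((-1) ^ s.p j))) (Finset.mem_univ j)).mul_left _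
    -- The parameter (-1)^p is its own inverse, so the two roots of the block coincide.
    · rw [RingHom.id_apply, ← mul_pow]
      simp

theorem StarCFCShape.blocks_of_isSep {n : ℕ} {s : StarCFCShape n} {α : Fin s.n₂ → ℂ}
    {μ : Fin s.n₃ → ℂ} (hα : ∀ j, α j ≠ 0) (h : IsSep (starRingEnd ℂ) (s.form α μ)) :
    IsEmpty (Fin s.n₁) ∧ (∀ j, s.l j = 1) ∧ (∀ j, s.m j = 1) := by
  have hp := pencil_starCFC_form (starRingEnd ℂ) s α μ
  refine ⟨⟨fun j => ?_⟩, fun j => ?_, fun j => ?_⟩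
  · refine not_isSep_of_jordanBlk (s.k_pos j) ?_ h
    rw [hp, mul_assoc]
    exact (Finset.dvd_prod_of_mem _ (Finset.mem_univ j)).mul_right _
  · refine gammaBlk_size_eq_one (τ := starRingEnd ℂ) (hα j) (s.l_pos j) (h.2.of_dvd ?_)
    rw [hp]
    exact ((Finset.dvd_prod_of_mem (fun j => pencil (starRingEnd ℂ) (α j • gammaBlk (s.l j)))
      (Finset.mem_univ j)).mul_left _).mul_right _
  · refine (hBlk_size_eq_one (τ := starRingEnd ℂ) (μ := μ j) (s.m_pos j) (h.2.of_dvd ?_)).1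
    rw [hp]
    exact (Finset.dvd_prod_of_mem (fun j => pencil (starRingEnd ℂ) (hBlk (s.m j) (μ j)))
      (Finset.mem_univ j)).mul_left _

/-- Every summand Γ_1 contributes the same root 1, so separability allows at most one. -/
theorem CFCShape.isSep_form_iff {n : ℕ} {s : CFCShape n} [IsEmpty (Fin s.n₁)]
    (hl : ∀ j, s.l j = 1) (hm : ∀ j, s.m j = 1) [IsEmpty (Fin s.n₄)] {μ : Fin s.n₃ → ℂ}
    (hμ : ∀ j, IsTypeIIa (μ j)) :
    IsSep (RingHom.id ℂ) (s.form μ) ↔ Subsingleton (Fin s.n₂) ∧ Function.Injective μ := by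
  have hμ0 : ∀ j, μ j ≠ 0 := fun j => isSelector_isTypeIIa.ne_zero _ (hμ j)
  obtain ⟨c, hc, h⟩ := prod_pencil_blocks (RingHom.id ℂ) hl hm (α := fun _ => 1)
    (fun _ => one_ne_zero) hμ0
  have hp := pencil_CFC_form (RingHom.id ℂ) s μ
  rw [Finset.univ_eq_empty, Finset.prod_empty, one_mul, Finset.univ_eq_empty (α := Fin s.n₄),
    Finset.prod_empty, mul_one, h] at hp
  rw [isSep_iff_injective (rootFun_ne_zero (by simp) hμ0) hc hp]
  constructor
  · intro hinj
    exact ⟨⟨fun i j => Sum.inl_injective (hinj (a₁ := .inl i) (a₂ := .inl j) rfl)⟩,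
      hinj.comp (Sum.inr_injective.comp Sum.inl_injective)⟩
  · rintro ⟨hs, hinj⟩
    exact isSelector_isTypeIIa.rootFun_injective (fun _ => rfl)
      (fun i j _ => Subsingleton.elim i j) hinj (by simp) hμ

theorem isSep_genericCFC {n : ℕ} {μ : Fin (n / 2) → ℂ} (hμ : GenericParams μ) :
    IsSep (RingHom.id ℂ) (genericCFC n μ) := by
  have hμ0 : ∀ j, μ j ≠ 0 := fun j => isSelector_isTypeIIa.ne_zero _ (hμ.1 j)
  obtain ⟨c, hc, h⟩ := prod_pencil_blocks (RingHom.id ℂ) (t := n % 2) (l := fun _ => 1)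
    (m := fun _ => 1) (fun _ => rfl) (fun _ => rfl) (α := fun _ => 1) (fun _ => one_ne_zero) hμ0
  have hp : pencil (RingHom.id ℂ) (genericCFC n μ) = _ :=
    (by simp only [genericCFC, pencil_resize, pencil_dirSum, pencil_bigDirSum, one_smul, mul_comm] :
      _ = _).trans h
  rw [isSep_iff_injective (rootFun_ne_zero (by simp) hμ0) hc hp]
  have : Subsingleton (Fin (n % 2)) :=
    Fin.subsingleton_iff_le_one.2 (Nat.le_of_lt_succ (Nat.mod_lt n two_pos))
  exact isSelector_isTypeIIa.rootFun_injective (fun _ => rfl)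
    (fun i j _ => Subsingleton.elim i j) (fun i j hij => not_imp_not.1 (hμ.2 i j) hij)
    (by simp) hμ.1

/-- At a fixed root f the diagonal entry satisfies b = f b with b ≠ 0, so f = 1. As the roots are
distinct, t ≤ 1, and the parity of n determines t and r. -/
theorem IsSep.exists_congruent_form {n : ℕ} {A : SqMat n} (hA : IsSep (RingHom.id ℂ) A) :
    ∃ μ : Fin (n / 2) → ℂ, (∀ i, IsTypeIIa (μ i)) ∧ Function.Injective μ ∧
      Congruent A ((genericShape n).form μ) := by
  obtain ⟨r, t, hn, hdet, f, μ, hinj, hDμ, hfix, hroot⟩ :=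
    hA.exists_hasRootType (fun _ => rfl) isSelector_isTypeIIa
  have hμ0 : ∀ j, μ j ≠ 0 := fun j => isSelector_isTypeIIa.ne_zero _ (hDμ j)
  have main := exists_twistedCongruent_normalForm (fun _ => rfl) hdet hinj hμ0 hfix hroot
  have ht : t ≤ 1 := by
    obtain ⟨b, hb0, hb, -⟩ := main (Fintype.equivFinOfCardEq (card_rootIndex hn))
    have hf1 : ∀ j, f j = 1 := fun j => mul_right_cancel₀ (hb0 j) (by
      rw [one_mul]; exact (hb j).symm)
    rw [← Fin.subsingleton_iff_le_one]
    exact ⟨fun i j => Sum.inl_injective (hinj (a₁ := .inl i) (a₂ := .inl j)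
      ((hf1 i).trans (hf1 j).symm))⟩
  obtain rfl : r = n / 2 := by omega
  obtain rfl : t = n % 2 := by omega
  obtain ⟨e, he⟩ := genericShape_form n
  obtain ⟨b, hb0, -, hb⟩ := main e
  -- Complex square roots of b⁻¹ normalize the diagonal entry to 1.
  choose c hc using fun j => IsAlgClosed.exists_pow_nat_eq (b j)⁻¹ two_pos
  have hc0 : ∀ j, c j ≠ 0 := fun j h => by
    have := hc j
    rw [h, zero_pow two_ne_zero, eq_comm, inv_eq_zero] at this
    exact hb0 j this
  refine ⟨μ, hDμ, hinj.comp (Sum.inr_injective.comp Sum.inl_injective), ?_⟩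
  rw [congruent_iff, he]
  have h1 : (fun j => c j * RingHom.id ℂ (c j) * b j) = fun _ => 1 := by
    funext j
    rw [RingHom.id_apply, ← pow_two, hc, inv_mul_cancel₀ (hb0 j)]
  rw [← h1]
  exact hb c hc0

/-- Separability passes from the generating matrix to its canonical form, thence by the bundle
conditions to the changed form and to M. Conversely, both separable matrices reduce to forms of the
same shape with distinct parameters. -/
theorem genericBundle_eq {n : ℕ} {μ : Fin (n / 2) → ℂ} (hμ : GenericParams μ) :
    genericBundle n μ = {A | IsSep (RingHom.id ℂ) A} := by
  ext M
  constructor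
  · rintro ⟨s, ν, hν, hA, ν', hν', hiff, hM⟩
    rw [congruent_iff] at hA hM
    have hs := (hA.isSep fun _ => rfl).1 (isSep_genericCFC hμ)
    obtain ⟨h1, hl, hm, h4⟩ := CFCShape.blocks_of_isSep hs
    rw [CFCShape.isSep_form_iff hl hm hν] at hs
    refine (hM.isSep fun _ => rfl).2 ((CFCShape.isSep_form_iff hl hm hν').2 ⟨hs.1, ?_⟩)
    intro i j hij
    exact hs.2 (not_not.1 fun h => (hiff i j).2 h hij)
  · intro hM
    obtain ⟨ν, hν, hνi, hA⟩ := (isSep_genericCFC hμ).exists_congruent_form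
    obtain ⟨ν', hν', hνi', hM⟩ := IsSep.exists_congruent_form hM
    exact ⟨genericShape n, ν, hν, hA, ν', hν',
      fun i j => hνi'.ne_iff.trans hνi.ne_iff.symm, hM⟩

/-! ### The generic bundles for `*`congruence -/

theorem ne_zero_of_norm_eq_one {ι : Type*} {α : ι → ℂ} (hα : ∀ j, ‖α j‖ = 1) (j : ι) :
    α j ≠ 0 := fun h => by simpa [h] using hα j

theorem hasRootType_genericStarCFC {n ℓ : ℕ} (hℓ : ℓ ≤ n / 2) {μ : Fin ℓ → ℂ}
    {α : Fin (n - 2 * ℓ) → ℂ} (h : GenericStarParams μ α) :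
    HasRootType (starRingEnd ℂ) (fun z => 1 < ‖z‖) ℓ (n - 2 * ℓ) (genericStarCFC hℓ μ α) := by
  obtain ⟨hμ, hμi, hα, hαi⟩ := h
  obtain ⟨c, hc, h⟩ := prod_pencil_blocks (starRingEnd ℂ) (l := fun _ => 1)
    (m := fun _ => 1) (fun _ => rfl) (fun _ => rfl) (ne_zero_of_norm_eq_one hα)
    (fun i => isSelector_one_lt_norm.ne_zero _ (hμ i))
  have hp : pencil (starRingEnd ℂ) (genericStarCFC hℓ μ α) = _ :=
    (by simp only [genericStarCFC, pencil_resize, pencil_dirSum, pencil_bigDirSum, mul_comm] :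
      _ = _).trans h
  refine hasRootType_of_pencil Complex.conj_conj isSelector_one_lt_norm
    (ne_zero_of_norm_eq_one hα) ?_ (fun i j hij => not_imp_not.1 (hμi i j) hij) hμ hc hp
  intro i j hij
  simp only [div_conj_eq_sq (hα _)] at hij
  exact not_imp_not.1 (hαi i j) hij

theorem StarCFCShape.pencil_form {n : ℕ} {s : StarCFCShape n} [IsEmpty (Fin s.n₁)]
    (hl : ∀ j, s.l j = 1) (hm : ∀ j, s.m j = 1) {α : Fin s.n₂ → ℂ} {μ : Fin s.n₃ → ℂ}
    (hα : ∀ j, α j ≠ 0) (hμ : ∀ j, μ j ≠ 0) : ∃ c : ℂ, c ≠ 0 ∧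
      pencil (starRingEnd ℂ) (s.form α μ) = C c *
        ∏ x, (X - C (rootFun (starRingEnd ℂ) (fun j => α j / starRingEnd ℂ (α j)) μ x)) := by
  obtain ⟨c, hc, h⟩ := prod_pencil_blocks (starRingEnd ℂ) hl hm hα hμ
  refine ⟨c, hc, ?_⟩
  rw [pencil_starCFC_form, ← h, Finset.univ_eq_empty, Finset.prod_empty, one_mul]

theorem HasRootType.exists_starCongruent_form {n ℓ : ℕ} (hℓ : ℓ ≤ n / 2) {A : SqMat n}
    (hA : HasRootType (starRingEnd ℂ) (fun z => 1 < ‖z‖) ℓ (n - 2 * ℓ) A) :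
    ∃ (α : Fin (n - 2 * ℓ) → ℂ) (μ : Fin ℓ → ℂ), (∀ j, ‖α j‖ = 1) ∧ (∀ i, 1 < ‖μ i‖) ∧
      (Function.Injective fun j => α j ^ 2) ∧ Function.Injective μ ∧
      StarCongruent A ((genericStarShape hℓ).form α μ) := by
  obtain ⟨hdet, f, μ, hinj, hDμ, hfix, hroot⟩ := hA
  obtain ⟨e, he⟩ := genericStarShape_form hℓ
  obtain ⟨b, hb0, hb, main⟩ := exists_twistedCongruent_normalForm Complex.conj_conj hdet hinj
    (fun i => isSelector_one_lt_norm.ne_zero _ (hDμ i)) hfix hroot e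
  -- With c = ‖b‖^(-1/2) the scaled entry is α = b/‖b‖; the relation between b and its conjugate
  -- then gives α² = f.
  set c : Fin (n - 2 * ℓ) → ℂ := fun j => ((Real.sqrt ‖b j‖)⁻¹ : ℝ) with hc
  have hpos : ∀ j, 0 < ‖b j‖ := fun j => norm_pos_iff.2 (hb0 j)
  have hcc : ∀ j, c j * starRingEnd ℂ (c j) = ((‖b j‖⁻¹ : ℝ) : ℂ) := fun j => by
    rw [hc, Complex.conj_ofReal, ← Complex.ofReal_mul, ← mul_inv,
      Real.mul_self_sqrt (norm_nonneg _)]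
  have hc0 : ∀ j, c j ≠ 0 := fun j => by
    rw [hc, Ne, Complex.ofReal_eq_zero]
    exact inv_ne_zero (Real.sqrt_pos.2 (hpos j)).ne'
  have hα : ∀ j, ‖c j * starRingEnd ℂ (c j) * b j‖ = 1 := fun j => by
    rw [hcc, norm_mul, Complex.norm_real, Real.norm_of_nonneg (by positivity),
      inv_mul_cancel₀ (hpos j).ne']
  have hsq : ∀ j, (c j * starRingEnd ℂ (c j) * b j) ^ 2 = f j := fun j => by
    rw [← div_conj_eq_sq (hα j), map_mul, hcc, Complex.conj_ofReal]
    have h1 : ((‖b j‖⁻¹ : ℝ) : ℂ) ≠ 0 := by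
      rw [Ne, Complex.ofReal_eq_zero]; exact inv_ne_zero (hpos j).ne'
    have h2 : starRingEnd ℂ (b j) ≠ 0 := by simpa using hb0 j
    rw [mul_div_mul_left _ _ h1, div_eq_iff h2]
    exact hb j
  refine ⟨fun j => c j * starRingEnd ℂ (c j) * b j, μ, hα, hDμ, ?_,
    hinj.comp (Sum.inr_injective.comp Sum.inl_injective), ?_⟩
  · simp only [hsq]
    exact hinj.comp Sum.inl_injective
  · rw [starCongruent_iff, he]
    exact main c hc0

theorem genericStarBundle_eq {n ℓ : ℕ} (hℓ : ℓ ≤ n / 2) {μ : Fin ℓ → ℂ}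
    {α : Fin (n - 2 * ℓ) → ℂ} (h : GenericStarParams μ α) :
    genericStarBundle hℓ μ α =
      {A | HasRootType (starRingEnd ℂ) (fun z => 1 < ‖z‖) ℓ (n - 2 * ℓ) A} := by
  have hn : n - 2 * ℓ + (ℓ + ℓ) = n := by omega
  have hgen := hasRootType_genericStarCFC hℓ h
  ext M
  constructor
  · rintro ⟨s, a, ν, ha, hν, hA, a', ν', ha', hν', hsq, -, hiff, hM⟩
    rw [starCongruent_iff] at hA hM
    have hs := (hA.hasRootType Complex.conj_conj).1 hgen
    obtain ⟨h1, hl, hm⟩ := StarCFCShape.blocks_of_isSep (ne_zero_of_norm_eq_one ha) (hs.isSep hn)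
    have hsize : s.n₂ + (s.n₃ + s.n₃) = n := by
      have := s.size_eq
      simp only [hl, hm, Finset.univ_eq_empty (α := Fin s.n₁), Finset.sum_empty, Finset.sum_const,
        Finset.card_univ, Fintype.card_fin, smul_eq_mul] at this
      omega
    have hν0 : ∀ i, ν i ≠ 0 := fun i => isSelector_one_lt_norm.ne_zero _ (hν i)
    obtain ⟨c, hc, hp⟩ := StarCFCShape.pencil_form hl hm (ne_zero_of_norm_eq_one ha) hν0
    have hinj := (isSep_iff_injective (rootFun_ne_zero
      (fun j => by simpa using ne_zero_of_norm_eq_one ha j) hν0) hc hp).1 (hs.isSep hn)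
    have hai : Function.Injective fun j => a j / starRingEnd ℂ (a j) :=
      hinj.comp Sum.inl_injective
    have hνi : Function.Injective ν := hinj.comp (Sum.inr_injective.comp Sum.inl_injective)
    have hs' := hasRootType_of_pencil Complex.conj_conj isSelector_one_lt_norm
      (ne_zero_of_norm_eq_one ha) hai hνi hν hc hp
    -- The shape s is arbitrary a priori; uniqueness of the root type fixes its numbers of blocks.
    obtain ⟨hr, ht⟩ := hs.unique Complex.conj_conj isSelector_one_lt_norm hn hsize hs'
    obtain ⟨c', hc', hp'⟩ := StarCFCShape.pencil_form hl hm (ne_zero_of_norm_eq_one ha')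
      fun i => isSelector_one_lt_norm.ne_zero _ (hν' i)
    have hM' := hasRootType_of_pencil Complex.conj_conj isSelector_one_lt_norm
      (ne_zero_of_norm_eq_one ha') (fun i j hij => by
        simp only [div_conj_eq_sq (ha' _)] at hij
        apply hai
        simp only [div_conj_eq_sq (ha _)]
        exact not_not.1 fun hne => (hsq i j (by rw [hl, hl])).2 hne hij)
      (fun i j hij => hνi (not_not.1 fun hne => (hiff i j).2 hne hij)) hν' hc' hp'
    rw [Set.mem_ofPred_eq, ht, hr]
    exact (hM.hasRootType Complex.conj_conj).2 hM'
  · intro hM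
    obtain ⟨a, ν, ha, hν, hai, hνi, hA⟩ := hgen.exists_starCongruent_form hℓ
    obtain ⟨a', ν', ha', hν', hai', hνi', hM⟩ := HasRootType.exists_starCongruent_form hℓ hM
    exact ⟨genericStarShape hℓ, a, ν, ha, hν, hA, a', ν', ha', hν',
      fun i j _ => (hai'.ne_iff (x := i) (y := j)).trans (hai.ne_iff (x := i) (y := j)).symm,
      fun i j hij => absurd rfl hij, fun i j => hνi'.ne_iff.trans hνi.ne_iff.symm, hM⟩

/-- Every separable matrix has some root type (r, t) with t + 2r = n, hence lies in the bundle with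
ℓ = r. -/
theorem iUnion_genericStarBundle_eq {n : ℕ} {μ : (ℓ : ℕ) → Fin ℓ → ℂ}
    {α : (ℓ : ℕ) → Fin (n - 2 * ℓ) → ℂ}
    (h : ∀ ℓ ≤ n / 2, GenericStarParams (μ ℓ) (α ℓ)) :
    (⋃ (ℓ : ℕ) (hℓ : ℓ ≤ n / 2), genericStarBundle hℓ (μ ℓ) (α ℓ)) =
      {A : SqMat n | IsSep (starRingEnd ℂ) A} := by
  ext A
  simp only [Set.mem_iUnion]
  constructor
  · rintro ⟨ℓ, hℓ, hA⟩
    rw [genericStarBundle_eq hℓ (h ℓ hℓ)] at hA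
    rw [Set.mem_ofPred_eq] at hA
    exact hA.isSep (by omega)
  · intro hA
    obtain ⟨r, t, hn, hA⟩ := IsSep.exists_hasRootType Complex.conj_conj isSelector_one_lt_norm hA
    have hr : r ≤ n / 2 := by omega
    obtain rfl : t = n - 2 * r := by omega
    refine ⟨r, hr, ?_⟩
    rw [genericStarBundle_eq hr (h r hr)]
    exact hA

end

end GenericBundles

/-! ### Openness and density of the generic bundles -/

theorem mainTheorem2 (n : ℕ) (hn : 1 ≤ n) :
    -- (a) the generic congruence bundle is open, and it is dense
    (∀ μ : Fin (n / 2) → ℂ, GenericParams μ →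
      (∀ A ∈ genericBundle n μ, ∃ ε > 0, frobeniusBall A ε ⊆ genericBundle n μ) ∧
      IsOpen (genericBundle n μ) ∧ Dense (genericBundle n μ)) ∧
    -- (b) each generic *congruence bundle is open
    (∀ (ℓ : ℕ) (hℓ : ℓ ≤ n / 2) (μ : Fin ℓ → ℂ) (α : Fin (n - 2 * ℓ) → ℂ),
      GenericStarParams μ α →
      (∀ A ∈ genericStarBundle hℓ μ α,
        ∃ ε > 0, frobeniusBall A ε ⊆ genericStarBundle hℓ μ α) ∧
      IsOpen (genericStarBundle hℓ μ α)) ∧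
    -- the union of the generic *congruence bundles is open and dense
    (∀ (μ : (ℓ : ℕ) → Fin ℓ → ℂ) (α : (ℓ : ℕ) → Fin (n - 2 * ℓ) → ℂ),
      (∀ ℓ ≤ n / 2, GenericStarParams (μ ℓ) (α ℓ)) →
      IsOpen (⋃ (ℓ : ℕ) (hℓ : ℓ ≤ n / 2), genericStarBundle hℓ (μ ℓ) (α ℓ)) ∧
      Dense (⋃ (ℓ : ℕ) (hℓ : ℓ ≤ n / 2), genericStarBundle hℓ (μ ℓ) (α ℓ))) := by
  have hn0 : n ≠ 0 := by omega
  refine ⟨fun μ hμ => ?_, fun ℓ hℓ μ α h => ?_, fun μ α h => ?_⟩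
  · have hopen : IsOpen (genericBundle n μ) := by
      rw [genericBundle_eq hμ]
      exact isOpen_isSep continuous_id
    refine ⟨fun A hA => exists_frobeniusBall_subset hopen hA, hopen, ?_⟩
    rw [genericBundle_eq hμ]
    exact dense_isSep (fun _ => rfl) hn0 (isSep_genericCFC hμ)
  · have hopen : IsOpen (genericStarBundle hℓ μ α) := by
      rw [genericStarBundle_eq hℓ h]
      exact isOpen_hasRootType Complex.conj_conj Complex.continuous_conj isSelector_one_lt_norm
        (isOpen_lt continuous_const continuous_norm) (by omega)
    exact ⟨fun A hA => exists_frobeniusBall_subset hopen hA, hopen⟩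
  · rw [iUnion_genericStarBundle_eq h]
    refine ⟨isOpen_isSep Complex.continuous_conj, ?_⟩
    -- Density needs one separable matrix; the generic form with ℓ = 0 provides it.
    exact dense_isSep Complex.conj_ofReal hn0
      ((hasRootType_genericStarCFC (Nat.zero_le _) (h 0 (Nat.zero_le _))).isSep (by omega))
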